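/- **Setting.** Labels $a,b$ run over the five tetrahedra $0,\dots,4$ of a 4-simplex and $\gamma\in\mathbb{R}$. Boundary data consist of spins $k_{ab}=k_{ba}\in\{\tfrac12,1,\tfrac32,\dots\}$ and unit spinors $\xi_{ab}\in\mathbb{C}^2$ ($a\ne b$). For a spinor $\xi$ put $\hat\xi=\xi/\|\xi\|$, $J(\xi_0,\xi_1)=(-\overline{\xi_1},\overline{\xi_0})$ and $\mathbf n_\xi=\langle\xi|\boldsymbol\sigma|\xi\rangle/\langle\xi,\xi\rangle$, with $\boldsymbol\sigma$ the Pauli matrices and $\langle\cdot,\cdot\rangle$ the Hermitian inner product, antilinear in the first slot; $[\xi]\in\mathbb{CP}^1$ is the class of $\xi$. The variables are $X_a\in \mathrm{SL}(2,\mathbb{C})$ and, for $a<b$, $[z_{ab}],[\eta_{ba}]\in\mathbb{CP}^1$. Put $X_{ab}=X_a^{-1}X_b$, $Z_{ab}=X_a^{-1}z_{ab}$, $Z_{ba}=X_b^{-1}z_{ab}$ ($a<b$), $v_{ab}^i=\tfrac12\mathrm{tr}(\sigma_iX_{ab}X_{ab}^\dagger)$, and $$\beta_{ab}=\mathrm{sgn}\big[\det(v_{ac},v_{ad},v_{ae})\,\det(v_{bc},v_{bd},v_{be})\big],\qquad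 \{a,b,c,d,e\}=\{0,\dots,4\},\quad \mathrm{sgn}\,0=0.$$ Let $C^k_\xi$ be the coherent state $\xi^{\otimes 2k}$ in the spin-$k$ representation of $\mathrm{SU}(2)$ (symmetric tensors), with Hermitian generators $\hat L^i$, and let $\Pi_{ba}$ be the spectral projector of $\beta_{ba}\,v_{ba}^i\hat L^i$ (spin $k_{ab}$) onto the part $(0,\infty)$ of its spectrum. The proper action is $$S^{(+)}=S^{\rm EPRL}+S^{\Pi},\qquad S^{\Pi}=\sum_{a<b}\log\big(C^{k_{ab}}_{\hat\eta_{ba}},\Pi_{ba}C^{k_{ab}}_{\xi_{ba}}\big),$$ $$S^{\rm EPRL}=\sum_{a<b}\Big(k_{ab}\log\frac{\langle Z_{ab},\xi_{ab}\rangle^2\langle J\hat\eta_{ba},Z_{ba}\rangle^2}{\langle Z_{ab},Z_{ab}\rangle\langle Z_{ba},Z_{ba}\rangle}+i\gamma k_{ab}\log\frac{\langle Z_{ba},Z_{ba}\rangle}{\langle Z_{ab},Z_{ab}\rangle}\Big),$$ defined, up to the choice of branch of the logarithms, where $X_{ab}\notin\mathrm{SU}(2)$ for all $a\neq b$ (the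 non-degenerate sector) and no logarithm is taken at $0$. A critical point is a point of this domain at which $\mathrm{Re}\,S^{(+)}$ attains its maximal value $0$ and all variations of $S^{(+)}$ with respect to $X_a$, $[z_{ab}]$, $[\eta_{ba}]$ vanish. Critical points of the EPRL action with boundary data $(k_{ab},\xi_{ab},\xi_{ba})$ are defined in the same way, for $S^{\rm EPRL}$ with $\eta_{ba}:=\xi_{ba}$ as a function of the $X_a$ and $[z_{ab}]$ only, without requiring non-degeneracy. **Theorem.** Given boundary data $\{k_{ab},\xi_{ab}\}$, the point $\{X_a,[z_{ab}],[\eta_{ba}]\}$ lies in the non-degenerate sector and is a critical point of $S^{(+)}$ if and only if all of the following hold: 1. (closure) $\sum_{b\neq a}k_{ab}\,\mathbf n_{\xi_{ab}}=0$ for every $a$; 2. (orientation) for all $a<b$ there is a $\theta_{ab}\in\mathbb{R}$ with $$X_a\xi_{ab}=\tfrac{\|Z_{ba}\|}{\|Z_{ab}\|}e^{i\theta_{ab}}X_bJ\hat\eta_{ba},\qquad (X_a^\dagger)^{-1}\xi_{ab}=\tfrac{\|Z_{ab}\|}{\|Z_{ba}\|}e^{i\theta_{ab}}(X_b^\dagger)^{-1}J\hat\eta_{ba};$$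 3. (proper orientation) $\beta_{ab}\,\mathbf n^i_{\xi_{ab}}\,\mathrm{tr}(X_{ab}X_{ab}^\dagger\sigma_i)>0$ for all $a\neq b$; 4. for each $a<b$, $[\eta_{ba}]=[\xi_{ba}]$, and $[z_{ab}]$ is the unique class such that, for some real $\phi_{ab},\phi_{ba}$, $$\xi_{ab}=\frac{e^{i\phi_{ab}}}{\|Z_{ab}\|}X_a^{-1}z_{ab},\qquad J\hat\eta_{ba}=\frac{e^{i\phi_{ba}}}{\|Z_{ba}\|}X_b^{-1}z_{ab}.$$ Equivalently: $\{X_a,[z_{ab}]\}$ is a critical point of the EPRL action with boundary data $(k_{ab},\xi_{ab},\xi_{ba})$, proper orientation (3) holds, and $[\eta_{ba}]=[\xi_{ba}]$ for all $a<b$. -/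

import Mathlib

noncomputable section

namespace SpinFoam

open Matrix

/-! ### Spinors -/

/-- Two-spinors, with the Hermitian inner product of `ℂ²` (antilinear in the first slot). -/
abbrev Spinor := EuclideanSpace ℂ (Fin 2)

/-- The complex projective line of spinors modulo rescaling. -/
abbrev CP1 := Projectivization ℂ Spinor

/-- The group `SL(2,ℂ)`. -/
abbrev SL2C := Matrix.SpecialLinearGroup (Fin 2) ℂ

/-- The antilinear structure map `(ξ₀, ξ₁) ↦ (-conj ξ₁, conj ξ₀)`. -/
def J (ξ : Spinor) : Spinor := !₂[-star (ξ 1), star (ξ 0)]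

/-- The normalized spinor `ξ / ‖ξ‖`. -/
def hat (ξ : Spinor) : Spinor := ((‖ξ‖⁻¹ : ℝ) : ℂ) • ξ

/-- A matrix acting on a spinor. -/
def act (M : Matrix (Fin 2) (Fin 2) ℂ) (ξ : Spinor) : Spinor := WithLp.toLp 2 (M *ᵥ ξ.ofLp)

/-- The three Pauli matrices. -/
def pauli : Fin 3 → Matrix (Fin 2) (Fin 2) ℂ :=
  ![!![0, 1; 1, 0], !![0, -Complex.I; Complex.I, 0], !![1, 0; 0, -1]]

/-- The unit 3-vector `⟨ξ|σ|ξ⟩ / ⟨ξ,ξ⟩` of a spinor (the quotient is real). -/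
def nvec (ξ : Spinor) : Fin 3 → ℝ := fun i =>
  (inner ℂ ξ (act (pauli i) ξ) / inner ℂ ξ ξ).re

/-! ### The spin `n/2` representation of `SU(2)`: symmetric tensors in `(ℂ²)^{⊗ n}` -/

/-- `(ℂ²)^{⊗ n}`, with the components of a tensor indexed by `Fin n → Fin 2`. -/
abbrev TensorPow (n : ℕ) := EuclideanSpace ℂ (Fin n → Fin 2)

/-- The irreducible representation of spin `n/2`: the symmetric tensors, a Hilbert space with the
inner product inherited from the tensor power. -/
def SpinRep (n : ℕ) : Submodule ℂ (TensorPow n) where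
  carrier := {f | ∀ (π : Equiv.Perm (Fin n)) (s : Fin n → Fin 2), f (s ∘ π) = f s}
  add_mem' := by
    intro f g hf hg π s
    simp only [PiLp.add_apply, hf π s, hg π s]
  zero_mem' := by
    intro π s
    simp
  smul_mem' := by
    intro c f hf π s
    simp only [PiLp.smul_apply, hf π s]

/-- One half of the sum over the `n` tensor slots of the matrix `M` acting in that slot. -/
def tensorGenerator (n : ℕ) (M : Matrix (Fin 2) (Fin 2) ℂ) : TensorPow n →ₗ[ℂ] TensorPow n where
  toFun f := WithLp.toLp 2 fun s =>
    (1 / 2 : ℂ) * ∑ r : Fin n, ∑ j : Fin 2, M (s r) j * f (Function.update s r j)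
  map_add' f g := by
    ext s
    simp [mul_add, Finset.sum_add_distrib]
  map_smul' c f := by
    ext s
    simp only [PiLp.smul_apply, smul_eq_mul, RingHom.id_apply, Finset.mul_sum]
    refine Finset.sum_congr rfl fun r _ => Finset.sum_congr rfl fun j _ => ?_
    ring

theorem tensorGenerator_mem (n : ℕ) (M : Matrix (Fin 2) (Fin 2) ℂ) :
    ∀ f ∈ SpinRep n, tensorGenerator n M f ∈ SpinRep n := by
  intro f hf π s
  simp only [tensorGenerator, LinearMap.coe_mk, AddHom.coe_mk]
  congr 1
  refine Fintype.sum_equiv π _ _ fun r => ?_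
  refine Finset.sum_congr rfl fun j _ => ?_
  have h : Function.update (s ∘ π) r j = (Function.update s (π r) j) ∘ π := by
    funext i
    by_cases hi : i = r
    · subst hi; simp
    · simp [Function.update_of_ne hi, Function.update_of_ne (fun h => hi (π.injective h))]
  rw [h, hf π]
  rfl

/-- The Hermitian generator `L_i` of `SU(2)` in the spin `n/2` representation. -/
def angularMomentum (n : ℕ) (i : Fin 3) : SpinRep n →ₗ[ℂ] SpinRep n :=
  (tensorGenerator n (pauli i)).restrict (tensorGenerator_mem n (pauli i))

/-- The coherent state `C^{n/2}_ξ = ξ^{⊗ n}`: the highest weight vector along `nvec ξ` for a unit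
spinor `ξ`, of norm one and with phase fixed by `⟨C_η, C_ξ⟩ = ⟨η, ξ⟩^n`. -/
def coherent (n : ℕ) (ξ : Spinor) : SpinRep n :=
  ⟨WithLp.toLp 2 fun s => ∏ r : Fin n, ξ (s r), by
    intro π s
    exact Fintype.prod_equiv π _ _ fun r => rfl⟩

/-- The spectral projector of a self-adjoint operator onto the part `S` of its spectrum: the
orthogonal projection onto the span of the eigenspaces with eigenvalue in `S`. -/
def spectralProjector {V : Type*} [NormedAddCommGroup V] [InnerProductSpace ℂ V]
    [FiniteDimensional ℂ V] (T : V →ₗ[ℂ] V) (S : Set ℝ) : V →L[ℂ] V :=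
  (⨆ μ ∈ S, Module.End.eigenspace T (μ : ℂ)).starProjection

/-! ### The 4-simplex, boundary data, integration variables -/

/-- Triangles of the 4-simplex: pairs `a < b` of tetrahedra. -/
abbrev Triangle := {e : Fin 5 × Fin 5 // e.1 < e.2}

/-- The smaller tetrahedron label of a triangle. -/
abbrev Triangle.a (e : Triangle) : Fin 5 := e.1.1

/-- The larger tetrahedron label of a triangle. -/
abbrev Triangle.b (e : Triangle) : Fin 5 := e.1.2

/-- Boundary data: a non-zero spin `k_ab = twoSpin a b / 2` for each unordered pair and a unit
spinor `ξ_ab` for each ordered pair of distinct tetrahedra (diagonal entries play no role). -/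
structure BoundaryData where
  twoSpin : Fin 5 → Fin 5 → ℕ
  twoSpin_comm : ∀ a b, twoSpin a b = twoSpin b a
  twoSpin_pos : ∀ a b, a ≠ b → 0 < twoSpin a b
  ξ : Fin 5 → Fin 5 → Spinor
  ξ_unit : ∀ a b, a ≠ b → ‖ξ a b‖ = 1

/-- The spin `k_ab`. -/
def BoundaryData.spin (B : BoundaryData) (a b : Fin 5) : ℝ := (B.twoSpin a b : ℝ) / 2

/-- The class `[ξ_ba]` for a triangle `a < b`. -/
def BoundaryData.ξClass (B : BoundaryData) (e : Triangle) : CP1 :=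
  Projectivization.mk ℂ (B.ξ e.b e.a) (by
    have h := B.ξ_unit e.b e.a (ne_of_gt e.2)
    intro h0
    rw [h0, norm_zero] at h
    exact zero_ne_one h)

/-- Values of the variables `X_a`, `z_ab`, `η_ba`, the last two as non-zero spinors. -/
structure Configuration where
  X : Fin 5 → SL2C
  z : Triangle → Spinor
  η : Triangle → Spinor
  z_ne : ∀ e, z e ≠ 0
  η_ne : ∀ e, η e ≠ 0

/-- Points `{X_a, [z_ab], [η_ba]}` of the integration domain. -/
structure Point where
  X : Fin 5 → SL2C
  z : Triangle → CP1
  η : Triangle → CP1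

/-- The point represented by a configuration. -/
def Configuration.toPoint (c : Configuration) : Point where
  X := c.X
  z e := Projectivization.mk ℂ (c.z e) (c.z_ne e)
  η e := Projectivization.mk ℂ (c.η e) (c.η_ne e)

/-- A choice of spinors representing a point. -/
def Point.rep (P : Point) : Configuration where
  X := P.X
  z e := (P.z e).rep
  η e := (P.η e).rep
  z_ne e := (P.z e).rep_nonzero
  η_ne e := (P.η e).rep_nonzero

/-! ### Group-theoretic data of the `X_a` -/

/-- `X_ab = X_a⁻¹ X_b`. -/
def rel (X : Fin 5 → SL2C) (a b : Fin 5) : SL2C := (X a)⁻¹ * X b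

/-- The non-degenerate sector: `X_ab ∉ SU(2)` for all `a ≠ b`. -/
def NonDegenerate (X : Fin 5 → SL2C) : Prop :=
  ∀ a b, a ≠ b → (rel X a b : Matrix (Fin 2) (Fin 2) ℂ) ∉ Matrix.specialUnitaryGroup (Fin 2) ℂ

/-- The real number `tr(σ_i X_ab X_ab†)`. -/
def traceVec (X : Fin 5 → SL2C) (a b : Fin 5) (i : Fin 3) : ℝ :=
  (Matrix.trace (pauli i * (rel X a b : Matrix (Fin 2) (Fin 2) ℂ) *
    (rel X a b : Matrix (Fin 2) (Fin 2) ℂ)ᴴ)).re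

/-- The spatial part `½ tr(σ_i X_ab X_ab†)` of the image of `(1,0,0,0)` under `X_ab`. -/
def boostVec (X : Fin 5 → SL2C) (a b : Fin 5) (i : Fin 3) : ℝ := traceVec X a b i / 2

/-- For `a ≠ b`, the three remaining tetrahedra, in increasing order. -/
def others (a b : Fin 5) (r : Fin 3) : Fin 5 :=
  ((List.finRange 5).filter fun c => c ≠ a ∧ c ≠ b).getD r 0

/-- The triple product `ε_{ijk} (X_ac 𝒯)^i (X_ad 𝒯)^j (X_ae 𝒯)^k` for `![c, d, e] = t`. -/
def tripleProduct (X : Fin 5 → SL2C) (a : Fin 5) (t : Fin 3 → Fin 5) : ℝ :=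
  (Matrix.of fun r i => boostVec X a (t r) i).det

/-- The sign `β_ab`, with value `0` if one of the two triple products vanishes. -/
def β (X : Fin 5 → SL2C) (a b : Fin 5) : ℝ :=
  Real.sign (tripleProduct X a (others a b) * tripleProduct X b (others a b))

/-- The projector `Π_ab`, in the spin `n/2` representation. -/
def properProjector (n : ℕ) (X : Fin 5 → SL2C) (a b : Fin 5) : SpinRep n →L[ℂ] SpinRep n :=
  spectralProjector (V := SpinRep n)
    (∑ i : Fin 3, ((β X a b * boostVec X a b i : ℝ) : ℂ) • angularMomentum n i)
    (Set.Ioi 0)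

/-! ### The action -/

/-- `Z_ab = X_a⁻¹ z_ab` for `a < b`. -/
def Configuration.Zab (c : Configuration) (e : Triangle) : Spinor :=
  act ((c.X e.a)⁻¹ : SL2C) (c.z e)

/-- `Z_ba = X_b⁻¹ z_ab` for `a < b`. -/
def Configuration.Zba (c : Configuration) (e : Triangle) : Spinor :=
  act ((c.X e.b)⁻¹ : SL2C) (c.z e)

/-- The argument `⟨Z_ab, ξ_ab⟩² ⟨J η̂_ba, Z_ba⟩² / (⟨Z_ab, Z_ab⟩ ⟨Z_ba, Z_ba⟩)` of the first
logarithm in the EPRL action. -/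
def eprlArg (B : BoundaryData) (c : Configuration) (e : Triangle) : ℂ :=
  inner ℂ (c.Zab e) (B.ξ e.a e.b) ^ 2 * inner ℂ (J (hat (c.η e))) (c.Zba e) ^ 2 /
    (inner ℂ (c.Zab e) (c.Zab e) * inner ℂ (c.Zba e) (c.Zba e))

/-- The argument `(C_{η̂_ba}, Π_ba C_{ξ_ba})` of the logarithm in the projector action. -/
def projArg (B : BoundaryData) (c : Configuration) (e : Triangle) : ℂ :=
  inner ℂ (coherent (B.twoSpin e.a e.b) (hat (c.η e)))
    (properProjector (B.twoSpin e.a e.b) c.X e.b e.a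
      (coherent (B.twoSpin e.a e.b) (B.ξ e.b e.a)))

/-- The branch of the logarithm which is analytic near `w₀ ≠ 0` and takes the principal value
at `w₀`. -/
def branchLog (w₀ w : ℂ) : ℂ := Complex.log w₀ + Complex.log (w / w₀)

/-- `S^EPRL` at `c`; the multivalued logarithms are given the branch which is analytic near their
argument at `c₀`. -/
def eprlAction (B : BoundaryData) (γ : ℝ) (c₀ c : Configuration) : ℂ :=
  ∑ e : Triangle,
    ((B.spin e.a e.b : ℂ) * branchLog (eprlArg B c₀ e) (eprlArg B c e) +
      Complex.I * (γ : ℂ) * (B.spin e.a e.b : ℂ) *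
        Complex.log (inner ℂ (c.Zba e) (c.Zba e) / inner ℂ (c.Zab e) (c.Zab e)))

/-- `S^Π` at `c`, with the branch of the logarithms determined by `c₀`. -/
def projAction (B : BoundaryData) (c₀ c : Configuration) : ℂ :=
  ∑ e : Triangle, branchLog (projArg B c₀ e) (projArg B c e)

/-- The proper action `S^(+) = S^EPRL + S^Π` at `c`, with the branch of the logarithms determined
by `c₀`. -/
def properAction (B : BoundaryData) (γ : ℝ) (c₀ c : Configuration) : ℂ :=
  eprlAction B γ c₀ c + projAction B c₀ c

/-- The domain of definition of `S^(+)`: the projectors are defined (non-degenerate sector) and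
no logarithm is taken at zero. -/
def InDomain (B : BoundaryData) (c : Configuration) : Prop :=
  NonDegenerate c.X ∧ ∀ e, eprlArg B c e ≠ 0 ∧ projArg B c e ≠ 0

/-! ### Critical points -/

/-- A variation of the point `P`: a path in the integration domain, given by representatives,
which starts at `P` and is differentiable there. -/
structure IsVariation (P : Point) (c : ℝ → Configuration) : Prop where
  start : (c 0).toPoint = P
  diff_X : ∀ a i j,
    DifferentiableAt ℝ (fun t => ((c t).X a : Matrix (Fin 2) (Fin 2) ℂ) i j) 0
  diff_z : ∀ e, DifferentiableAt ℝ (fun t => (c t).z e) 0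
  diff_η : ∀ e, DifferentiableAt ℝ (fun t => (c t).η e) 0

/-- Critical points of `S^(+)`: points of its domain where the real part attains its maximal
value `0` and the derivative of the action along every variation vanishes. -/
structure IsCriticalPoint (B : BoundaryData) (γ : ℝ) (P : Point) : Prop where
  inDomain : InDomain B P.rep
  re_eq_zero : (properAction B γ P.rep P.rep).re = 0
  re_max : ∀ Q : Point, InDomain B Q.rep →
    (properAction B γ Q.rep Q.rep).re ≤ (properAction B γ P.rep P.rep).re
  stationary : ∀ c : ℝ → Configuration, IsVariation P c →
    HasDerivAt (fun t => properAction B γ (c 0) (c t)) 0 0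

/-- The configuration with `η_ba` replaced by the boundary spinor `ξ_ba`. -/
def Configuration.withBoundary (B : BoundaryData) (c : Configuration) : Configuration where
  X := c.X
  z := c.z
  η e := B.ξ e.b e.a
  z_ne := c.z_ne
  η_ne e := by
    have h := B.ξ_unit e.b e.a (ne_of_gt e.2)
    intro h0
    rw [h0, norm_zero] at h
    exact zero_ne_one h

/-- Critical points `{X_a, [z_ab]}` of the EPRL action with boundary data `ξ_ab, ξ_ba`, as a
function of `X_a` and `z_ab` only (the component `η` of `P` plays no role): the logarithms are
defined, the real part attains its maximal value `0`, and the action is stationary. -/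
structure IsEPRLCriticalPoint (B : BoundaryData) (γ : ℝ) (P : Point) : Prop where
  inDomain : ∀ e, eprlArg B (P.rep.withBoundary B) e ≠ 0
  re_eq_zero : (eprlAction B γ (P.rep.withBoundary B) (P.rep.withBoundary B)).re = 0
  re_max : ∀ Q : Point, (∀ e, eprlArg B (Q.rep.withBoundary B) e ≠ 0) →
    (eprlAction B γ (Q.rep.withBoundary B) (Q.rep.withBoundary B)).re ≤
      (eprlAction B γ (P.rep.withBoundary B) (P.rep.withBoundary B)).re
  stationary : ∀ c : ℝ → Configuration, IsVariation P c →
    HasDerivAt (fun t => eprlAction B γ ((c 0).withBoundary B) ((c t).withBoundary B)) 0 0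

/-! ### Closure, orientation, proper orientation, maximality equation -/

/-- Closure: `∑_{b ≠ a} k_ab n_ab = 0` for every tetrahedron `a`. -/
def Closure (B : BoundaryData) : Prop :=
  ∀ (a : Fin 5) (i : Fin 3),
    ∑ b ∈ Finset.univ.erase a, B.spin a b * nvec (B.ξ a b) i = 0

/-- Orientation: for each `a < b` there is a phase `θ_ab` with
`X_a ξ_ab = (‖Z_ba‖ / ‖Z_ab‖) e^{iθ_ab} X_b J η̂_ba` and
`(X_a†)⁻¹ ξ_ab = (‖Z_ab‖ / ‖Z_ba‖) e^{iθ_ab} (X_b†)⁻¹ J η̂_ba`. -/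
def Oriented (B : BoundaryData) (c : Configuration) : Prop :=
  ∀ e : Triangle, ∃ θ : ℝ,
    act (c.X e.a) (B.ξ e.a e.b) =
        (((‖c.Zba e‖ / ‖c.Zab e‖ : ℝ) : ℂ) * Complex.exp (Complex.I * θ)) •
          act (c.X e.b) (J (hat (c.η e))) ∧
      act ((c.X e.a : Matrix (Fin 2) (Fin 2) ℂ)ᴴ)⁻¹ (B.ξ e.a e.b) =
        (((‖c.Zab e‖ / ‖c.Zba e‖ : ℝ) : ℂ) * Complex.exp (Complex.I * θ)) •
          act ((c.X e.b : Matrix (Fin 2) (Fin 2) ℂ)ᴴ)⁻¹ (J (hat (c.η e)))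

/-- The additional inequality of proper orientation:
`β_ab n_ab^i tr(X_ab X_ab† σ_i) > 0` for all `a ≠ b`. -/
def ProperlyOriented (B : BoundaryData) (X : Fin 5 → SL2C) : Prop :=
  ∀ a b, a ≠ b → 0 < β X a b * ∑ i : Fin 3, nvec (B.ξ a b) i * traceVec X a b i

/-- The maximality equations at the triangle `e`:
`ξ_ab = (e^{iφ_ab} / ‖Z_ab‖) X_a⁻¹ z_ab` and `J η̂_ba = (e^{iφ_ba} / ‖Z_ba‖) X_b⁻¹ z_ab`. -/
def MaxEquation (B : BoundaryData) (c : Configuration) (e : Triangle) : Prop :=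
  ∃ φ φ' : ℝ,
    B.ξ e.a e.b = (Complex.exp (Complex.I * φ) / (‖c.Zab e‖ : ℂ)) • c.Zab e ∧
      J (hat (c.η e)) = (Complex.exp (Complex.I * φ') / (‖c.Zba e‖ : ℂ)) • c.Zba e

/-- `[z_ab]` solves the maximality equations and is their only solution, the other variables
being fixed. -/
def DeterminedByMax (B : BoundaryData) (P : Point) (e : Triangle) : Prop :=
  MaxEquation B P.rep e ∧
    ∀ Q : Point, Q.X = P.X → Q.η = P.η → MaxEquation B Q.rep e → Q.z e = P.z e

end SpinFoam

end

noncomputable section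

namespace SpinFoam

open Matrix

/-! ### Algebra of spinors -/

/-! Every logarithm in the real part has an argument of modulus at most one: by Cauchy-Schwarz for
the EPRL factors, and because an orthogonal projector contracts for the others. Hence the value `0`
is attained only if every inequality is saturated. For the EPRL factors this means `Aligned`, the
maximality equations up to scale (`norm_eprlArg_eq_one_iff`). For the projector factors it means
that `C_ξ` lies in the range of the projector and `η` is parallel to `ξ_ba`
(`norm_projArg_eq_one_iff`). A coherent state lies in the positive spectral space only if its spinor
is itself the positive eigenvector of `w · σ` (`act_pauliVec_of_mem_posSpace`), which is
`HighestWeight`.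

At such a point the first variation is explicit. Moving the projector changes the amplitude only to
second order (`hasDerivAt_projected`). The velocity of `η` enters the two parts of the action with
opposite effect, because `η̂` stays normalized and `J` is antiunitary
(`IsVariation.hasDerivAt_properAction`). What is left is `i (Im F + γ Re F)`, where `F`, the sum of
`2k · flow`, is complex linear in the velocities of `X` and `z`. Testing a direction and `i` times
it gives two real equations with determinant `1 + γ²` up to sign, so `F` vanishes for every real `γ`
(`eq_zero_of_phaseForm`). The `X`-directions yield closure and the `z`-directions yield `defect = 0`
(`stationary_iff`). Given alignment, the latter is the orientation condition
(`oriented_iff_defect`).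

Orientation makes `J ξ_ba` an eigenvector of `X_ba X_ba†`, so `ξ_ba` is an eigenvector of `v_ba ·
σ`, and the highest weight condition reduces to the sign of its eigenvalue multiplied by `β`. That
sign is the proper orientation inequality (`Intertwines.highestWeight`,
`properlyOriented_of_highestWeight`). With `η` frozen at `ξ_ba` the EPRL action has the same first
variation, hence the same conditions without the sign; this gives the second equivalence. -/

theorem inner_spinor (u v : Spinor) : inner ℂ u v = star (u 0) * v 0 + star (u 1) * v 1 := by
  simp [PiLp.inner_apply, Fin.sum_univ_two, mul_comm]

@[simp] theorem act_apply_zero (M : Matrix (Fin 2) (Fin 2) ℂ) (u : Spinor) :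
    act M u 0 = M 0 0 * u 0 + M 0 1 * u 1 := by
  simp [act]

@[simp] theorem act_apply_one (M : Matrix (Fin 2) (Fin 2) ℂ) (u : Spinor) :
    act M u 1 = M 1 0 * u 0 + M 1 1 * u 1 := by
  simp [act]

@[simp] theorem J_apply_zero (u : Spinor) : J u 0 = -star (u 1) := by simp [J]

@[simp] theorem J_apply_one (u : Spinor) : J u 1 = star (u 0) := by simp [J]

theorem spinor_ext {u v : Spinor} (h0 : u 0 = v 0) (h1 : u 1 = v 1) : u = v := by
  ext i
  fin_cases i
  · exact h0
  · exact h1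

theorem act_mul (A C : Matrix (Fin 2) (Fin 2) ℂ) (u : Spinor) : act (A * C) u = act A (act C u) := by
  rw [act, act, act, Matrix.mulVec_mulVec]

@[simp] theorem act_one (u : Spinor) : act 1 u = u := by
  simp [act]

theorem act_smul (A : Matrix (Fin 2) (Fin 2) ℂ) (c : ℂ) (u : Spinor) :
    act A (c • u) = c • act A u := by
  rw [act, WithLp.ofLp_smul, Matrix.mulVec_smul]
  rfl

theorem act_add (A : Matrix (Fin 2) (Fin 2) ℂ) (u v : Spinor) :
    act A (u + v) = act A u + act A v := by
  rw [act, WithLp.ofLp_add, Matrix.mulVec_add]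
  rfl

theorem act_sub (A : Matrix (Fin 2) (Fin 2) ℂ) (u v : Spinor) :
    act A (u - v) = act A u - act A v := by
  rw [act, WithLp.ofLp_sub, Matrix.mulVec_sub]
  rfl

theorem add_act (A C : Matrix (Fin 2) (Fin 2) ℂ) (u : Spinor) :
    act (A + C) u = act A u + act C u := by
  rw [act, Matrix.add_mulVec]
  rfl

theorem smul_act (c : ℂ) (A : Matrix (Fin 2) (Fin 2) ℂ) (u : Spinor) :
    act (c • A) u = c • act A u := by
  rw [act, Matrix.smul_mulVec]
  rfl

theorem inner_act_left (A : Matrix (Fin 2) (Fin 2) ℂ) (u v : Spinor) :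
    inner ℂ (act A u) v = inner ℂ u (act Aᴴ v) := by
  simp only [inner_spinor, act_apply_zero, act_apply_one, Matrix.conjTranspose_apply, star_add,
    star_mul']
  ring

theorem inner_act_right (A : Matrix (Fin 2) (Fin 2) ℂ) (u v : Spinor) :
    inner ℂ u (act A v) = inner ℂ (act Aᴴ u) v := by
  rw [inner_act_left, Matrix.conjTranspose_conjTranspose]

theorem inner_J_J (u v : Spinor) : inner ℂ (J u) (J v) = inner ℂ v u := by
  simp only [inner_spinor, J_apply_zero, J_apply_one, star_neg, star_star]
  ring

theorem inner_self_J (u : Spinor) : inner ℂ u (J u) = 0 := by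
  simp only [inner_spinor, J_apply_zero, J_apply_one]
  ring

theorem J_J (u : Spinor) : J (J u) = -u := by
  apply spinor_ext <;> simp

theorem J_add (u v : Spinor) : J (u + v) = J u + J v := by
  apply spinor_ext
  · simp; ring
  · simp

theorem J_smul (c : ℂ) (u : Spinor) : J (c • u) = star c • J u := by
  apply spinor_ext <;> simp

theorem norm_J (u : Spinor) : ‖J u‖ = ‖u‖ := by
  have h := inner_J_J u u
  rw [inner_self_eq_norm_sq_to_K, inner_self_eq_norm_sq_to_K] at h
  have h2 : ‖J u‖ ^ 2 = ‖u‖ ^ 2 := by exact_mod_cast h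
  exact (sq_eq_sq₀ (norm_nonneg _) (norm_nonneg _)).1 h2

/-- Expansion of a spinor in the orthogonal basis `u, J u`. -/
theorem inner_self_smul (u v : Spinor) :
    inner ℂ u u • v = inner ℂ u v • u + inner ℂ (J u) v • J u := by
  apply spinor_ext <;>
  · simp only [inner_spinor, J_apply_zero, J_apply_one, star_neg, star_star, PiLp.smul_apply,
      PiLp.add_apply, smul_eq_mul]
    ring

theorem eq_zero_of_inner {u v : Spinor} (hu : u ≠ 0) (h1 : inner ℂ v u = 0)
    (h2 : inner ℂ v (J u) = 0) : v = 0 := by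
  have h := inner_self_smul u v
  rw [← inner_conj_symm u v, ← inner_conj_symm (J u) v, h1, h2] at h
  simp only [map_zero, zero_smul, add_zero, smul_eq_zero, inner_self_eq_zero] at h
  exact h.resolve_left hu

theorem norm_hat {u : Spinor} (h : u ≠ 0) : ‖hat u‖ = 1 := by
  rw [hat, norm_smul, Complex.norm_real, norm_inv, norm_norm, inv_mul_cancel₀ (norm_ne_zero_iff.2 h)]

theorem inner_self_of_norm_one {u : Spinor} (h : ‖u‖ = 1) : inner ℂ u u = (1 : ℂ) := by
  rw [inner_self_eq_norm_sq_to_K, h]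
  simp

theorem ne_zero_of_norm_one {u : Spinor} (h : ‖u‖ = 1) : u ≠ 0 := by
  rintro rfl
  simp at h

/-- A unimodular matrix and the inverse of its adjoint are conjugate under `J`. -/
theorem J_act_SL (X : SL2C) (u : Spinor) :
    J (act (X : Matrix (Fin 2) (Fin 2) ℂ) u) =
      act ((X⁻¹ : SL2C) : Matrix (Fin 2) (Fin 2) ℂ)ᴴ (J u) := by
  apply spinor_ext <;>
    simp [Matrix.SpecialLinearGroup.coe_inv, Matrix.adjugate_fin_two, Matrix.conjTranspose_apply]
  ring

theorem act_inv_act (X : SL2C) (u : Spinor) :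
    act ((X⁻¹ : SL2C) : Matrix (Fin 2) (Fin 2) ℂ) (act (X : Matrix (Fin 2) (Fin 2) ℂ) u) = u := by
  rw [← act_mul, ← Matrix.SpecialLinearGroup.coe_mul]
  simp

theorem act_act_inv (X : SL2C) (u : Spinor) :
    act (X : Matrix (Fin 2) (Fin 2) ℂ) (act ((X⁻¹ : SL2C) : Matrix (Fin 2) (Fin 2) ℂ) u) = u := by
  rw [← act_mul, ← Matrix.SpecialLinearGroup.coe_mul]
  simp

theorem act_inv_ne_zero (X : SL2C) {u : Spinor} (h : u ≠ 0) :
    act ((X⁻¹ : SL2C) : Matrix (Fin 2) (Fin 2) ℂ) u ≠ 0 := by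
  intro h0
  apply h
  rw [← act_act_inv X u, h0]
  apply spinor_ext <;> simp

theorem conjTranspose_inv_SL (X : SL2C) :
    ((X : Matrix (Fin 2) (Fin 2) ℂ)ᴴ)⁻¹ = ((X⁻¹ : SL2C) : Matrix (Fin 2) (Fin 2) ℂ)ᴴ := by
  apply Matrix.inv_eq_right_inv
  rw [← Matrix.conjTranspose_mul, ← Matrix.SpecialLinearGroup.coe_mul]
  simp

/-! ### Pauli matrices -/

/-- The matrix `w · σ`. -/
def pauliVec (w : Fin 3 → ℝ) : Matrix (Fin 2) (Fin 2) ℂ := ∑ i, ((w i : ℝ) : ℂ) • pauli i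

theorem pauliVec_eq (w : Fin 3 → ℝ) :
    pauliVec w = !![(w 2 : ℂ), w 0 - w 1 * Complex.I; w 0 + w 1 * Complex.I, -(w 2 : ℂ)] := by
  ext i j
  fin_cases i <;> fin_cases j <;> simp [pauliVec, pauli, Fin.sum_univ_three, sub_eq_add_neg]

theorem conjTranspose_pauliVec (w : Fin 3 → ℝ) : (pauliVec w)ᴴ = pauliVec w := by
  rw [pauliVec_eq]
  ext i j
  fin_cases i <;> fin_cases j <;> simp [sub_eq_add_neg]

theorem pauliVec_smul (c : ℝ) (w : Fin 3 → ℝ) :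
    pauliVec (fun i => c * w i) = (c : ℂ) • pauliVec w := by
  rw [pauliVec, pauliVec, Finset.smul_sum]
  refine Finset.sum_congr rfl fun i _ => ?_
  rw [smul_smul, Complex.ofReal_mul]

/-- The Euclidean length of a 3-vector. -/
def len (w : Fin 3 → ℝ) : ℝ := Real.sqrt (∑ i, w i ^ 2)

theorem len_nonneg (w : Fin 3 → ℝ) : 0 ≤ len w := Real.sqrt_nonneg _

theorem len_sq (w : Fin 3 → ℝ) : len w ^ 2 = ∑ i, w i ^ 2 :=
  Real.sq_sqrt (Finset.sum_nonneg fun _ _ => sq_nonneg _)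

theorem len_pos {w : Fin 3 → ℝ} (h : w ≠ 0) : 0 < len w := by
  refine lt_of_le_of_ne (len_nonneg w) fun h0 => h ?_
  have h1 := len_sq w
  rw [← h0] at h1
  have h2 := (Finset.sum_eq_zero_iff_of_nonneg fun i _ => sq_nonneg (w i)).1
    (h1.symm.trans (by norm_num))
  funext i
  exact pow_eq_zero_iff (two_ne_zero) |>.1 (h2 i (Finset.mem_univ i))

/-- The Clifford relation `(w · σ)² = |w|²`: the only possible eigenvalues are `± len w`, and `w · σ
± len w` maps onto the eigenspinors. -/
theorem pauliVec_act_act (w : Fin 3 → ℝ) (u : Spinor) :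
    act (pauliVec w) (act (pauliVec w) u) = ((len w : ℂ) ^ 2) • u := by
  have h : ((len w : ℂ) ^ 2) = (w 0 : ℂ) ^ 2 + (w 1 : ℂ) ^ 2 + (w 2 : ℂ) ^ 2 := by
    have := len_sq w
    rw [Fin.sum_univ_three] at this
    exact_mod_cast this
  rw [h, pauliVec_eq]
  apply spinor_ext
  · simp
    linear_combination (-(w 1 : ℂ) ^ 2 * u 0) * Complex.I_sq
  · simp
    linear_combination (-(w 1 : ℂ) ^ 2 * u 1) * Complex.I_sq

/-- `w · σ` applied to the projection of a spinor onto the positive eigenspace. -/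
theorem pauliVec_act_proj (w : Fin 3 → ℝ) (u : Spinor) :
    act (pauliVec w) (act (pauliVec w) u + (len w : ℂ) • u) =
      (len w : ℂ) • (act (pauliVec w) u + (len w : ℂ) • u) := by
  rw [act_add, pauliVec_act_act, act_smul, smul_add, smul_smul, sq, add_comm]

/-- Pauli matrices are Hermitian, so the real part taken in `nvec` loses nothing. -/
theorem inner_pauliVec (w : Fin 3 → ℝ) {u : Spinor} (hu : ‖u‖ = 1) :
    inner ℂ u (act (pauliVec w) u) = ((∑ i, nvec u i * w i : ℝ) : ℂ) := by
  have h1 := inner_self_of_norm_one hu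
  have h : ∀ i, ((nvec u i : ℝ) : ℂ) = inner ℂ u (act (pauli i) u) := by
    intro i
    rw [nvec, h1, div_one]
    refine (Complex.conj_eq_iff_re.1 ?_)
    rw [inner_conj_symm, inner_act_left]
    congr 2
    ext a b
    fin_cases i <;> fin_cases a <;> fin_cases b <;> simp [pauli]
  push_cast
  rw [Fin.sum_univ_three, h, h, h, pauliVec]
  simp only [Fin.sum_univ_three, add_act, smul_act, inner_add_right, inner_smul_right]
  ring

/-- `J` reverses the spin direction; this exchanges the eigenspinors of `w · σ`. -/
theorem J_pauliVec (w : Fin 3 → ℝ) (u : Spinor) :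
    J (act (pauliVec w) u) = -act (pauliVec w) (J u) := by
  rw [pauliVec_eq]
  apply spinor_ext <;> simp
  ring

/-- Expansion of `X X†` in Pauli matrices. -/
theorem mul_conjTranspose_eq (M : Matrix (Fin 2) (Fin 2) ℂ) :
    M * Mᴴ = (((∑ i, ∑ j, ‖M i j‖ ^ 2) / 2 : ℝ) : ℂ) • (1 : Matrix (Fin 2) (Fin 2) ℂ) +
      pauliVec fun i => (Matrix.trace (pauli i * M * Mᴴ)).re / 2 := by
  rw [pauliVec_eq]
  ext i j
  fin_cases i <;> fin_cases j <;>
  · simp only [Matrix.trace_fin_two, Matrix.mul_apply, Fin.sum_univ_two,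
      Matrix.conjTranspose_apply, ← Complex.normSq_eq_norm_sq, Complex.normSq_apply]
    apply Complex.ext <;> simp [pauli] <;> ring

/-! ### Coherent states and the generators -/

theorem inner_coherent (n : ℕ) (u v : Spinor) :
    inner ℂ (coherent n u) (coherent n v) = (inner ℂ u v : ℂ) ^ n := by
  have h : (inner ℂ u v : ℂ) = ∑ j, star (u j) * v j := by
    rw [inner_spinor, Fin.sum_univ_two]
  rw [h, Submodule.coe_inner, PiLp.inner_apply, ← Fin.prod_const, Finset.prod_univ_sum,
    Fintype.piFinset_univ]
  refine Finset.sum_congr rfl fun s _ => ?_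
  simp only [coherent, RCLike.inner_apply, Finset.prod_mul_distrib, map_prod]
  exact mul_comm _ _

theorem norm_coherent (n : ℕ) {u : Spinor} (h : ‖u‖ = 1) : ‖coherent n u‖ = 1 := by
  have h1 := inner_coherent n u u
  rw [inner_self_of_norm_one h, one_pow] at h1
  have h2 : ‖coherent n u‖ ^ 2 = 1 := by
    have h3 := inner_self_eq_norm_sq (𝕜 := ℂ) (coherent n u)
    rw [h1] at h3
    simpa using h3.symm
  exact (pow_eq_one_iff_of_nonneg (norm_nonneg _) two_ne_zero).1 h2

/-- Each of the `n` slots reproduces the tensor power with a factor `l`, and the generator carries a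
factor one half. -/
theorem tensorGenerator_coherent (n : ℕ) (M : Matrix (Fin 2) (Fin 2) ℂ) {u : Spinor} {l : ℂ}
    (h : act M u = l • u) :
    tensorGenerator n M (coherent n u) = ((n : ℂ) / 2 * l) • (coherent n u : TensorPow n) := by
  have h' : ∀ i, ∑ j, M i j * u j = l * u i := by
    intro i
    rw [Fin.sum_univ_two]
    fin_cases i
    · simpa using congrArg (fun x : Spinor => x 0) h
    · simpa using congrArg (fun x : Spinor => x 1) h
  ext s
  simp only [tensorGenerator, coherent, LinearMap.coe_mk, AddHom.coe_mk, PiLp.smul_apply,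
    smul_eq_mul]
  have h1 : ∀ r : Fin n, ∑ j, M (s r) j * ∏ i, u (Function.update s r j i) =
      l * ∏ i, u (s i) := by
    intro r
    have h2 : ∀ j, ∏ i, u (Function.update s r j i) =
        u j * ∏ i ∈ Finset.univ.erase r, u (s i) := by
      intro j
      rw [← Finset.mul_prod_erase _ _ (Finset.mem_univ r), Function.update_self]
      congr 1
      refine Finset.prod_congr rfl fun i hi => ?_
      rw [Function.update_of_ne (Finset.ne_of_mem_erase hi)]
    rw [← Finset.mul_prod_erase _ _ (Finset.mem_univ r), ← mul_assoc, ← h', Finset.sum_mul]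
    refine Finset.sum_congr rfl fun j _ => ?_
    rw [h2, mul_assoc]
  rw [Finset.sum_congr rfl fun r _ => h1 r, Finset.sum_const, Finset.card_univ, Fintype.card_fin,
    nsmul_eq_mul]
  ring

/-- Exchanging the value of a multi-index at `r` with an external index. -/
theorem sum_update_swap {n : ℕ} (r : Fin n) (F : (Fin n → Fin 2) → Fin 2 → ℂ) :
    ∑ s, ∑ j, F (Function.update s r j) (s r) = ∑ s, ∑ j, F s j := by
  rw [← Fintype.sum_prod_type', ← Fintype.sum_prod_type']
  have hi : Function.Involutive
      (fun p : (Fin n → Fin 2) × Fin 2 => (Function.update p.1 r p.2, p.1 r)) := by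
    rintro ⟨s, j⟩
    simp
  exact Fintype.sum_equiv hi.toPerm _ _ fun p => rfl

/-- Slot by slot, exchanging the index `s r` with the summation index `j` moves `M` from one factor
to the other. -/
theorem inner_tensorGenerator (n : ℕ) {M : Matrix (Fin 2) (Fin 2) ℂ} (hM : Mᴴ = M)
    (f g : TensorPow n) :
    inner ℂ (tensorGenerator n M f) g = inner ℂ f (tensorGenerator n M g) := by
  have hM' : ∀ i j, star (M i j) = M j i := fun i j => by
    rw [← Matrix.conjTranspose_apply, hM]
  simp only [PiLp.inner_apply, RCLike.inner_apply, tensorGenerator, LinearMap.coe_mk,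
    AddHom.coe_mk, map_mul, map_sum, Finset.mul_sum, Finset.sum_mul]
  rw [Finset.sum_comm (s := Finset.univ (α := Fin n → Fin 2)),
    Finset.sum_comm (s := Finset.univ (α := Fin n → Fin 2))]
  refine Finset.sum_congr rfl fun r _ => ?_
  rw [← sum_update_swap r]
  refine Finset.sum_congr rfl fun s _ => Finset.sum_congr rfl fun j _ => ?_
  have h := hM' j (s r)
  rw [← starRingEnd_apply] at h
  simp only [Function.update_self, Function.update_idem, Function.update_eq_self, h]
  have h2 : (starRingEnd ℂ) (1 / 2 : ℂ) = 1 / 2 := by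
    simpa using Complex.conj_ofReal (1 / 2)
  rw [h2]
  ring

/-- The operator `w · L` in the spin `n/2` representation. -/
def boostOp (n : ℕ) (w : Fin 3 → ℝ) : SpinRep n →ₗ[ℂ] SpinRep n :=
  ∑ i : Fin 3, ((w i : ℝ) : ℂ) • angularMomentum n i

theorem coe_boostOp (n : ℕ) (w : Fin 3 → ℝ) (f : SpinRep n) :
    (boostOp n w f : TensorPow n) = tensorGenerator n (pauliVec w) f := by
  have h : ∀ i, (angularMomentum n i f : TensorPow n) = tensorGenerator n (pauli i) f :=
    fun i => rfl
  simp only [boostOp, LinearMap.sum_apply, LinearMap.smul_apply, Submodule.coe_sum,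
    Submodule.coe_smul, h]
  ext s
  simp only [tensorGenerator, LinearMap.coe_mk, AddHom.coe_mk, Fin.sum_univ_three, pauliVec,
    PiLp.add_apply, PiLp.smul_apply, smul_eq_mul, Matrix.add_apply, Matrix.smul_apply, add_mul,
    Finset.sum_add_distrib, Finset.mul_sum]
  simp only [mul_add, Finset.mul_sum, mul_assoc, mul_left_comm]

theorem boostOp_symm (n : ℕ) (w : Fin 3 → ℝ) (f g : SpinRep n) :
    inner ℂ (boostOp n w f) g = inner ℂ f (boostOp n w g) := by
  rw [Submodule.coe_inner, Submodule.coe_inner, coe_boostOp, coe_boostOp,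
    inner_tensorGenerator n (conjTranspose_pauliVec w)]

theorem boostOp_coherent (n : ℕ) (w : Fin 3 → ℝ) {u : Spinor} {l : ℂ}
    (h : act (pauliVec w) u = l • u) :
    boostOp n w (coherent n u) = ((n : ℂ) / 2 * l) • coherent n u := by
  apply Subtype.ext
  rw [coe_boostOp, tensorGenerator_coherent n _ h]
  rfl

/-! ### Positive spectral subspaces and coherent states -/

/-- The range of `spectralProjector T S`. -/
def spectralSpace {V : Type*} [NormedAddCommGroup V] [InnerProductSpace ℂ V] (T : V →ₗ[ℂ] V)
    (S : Set ℝ) : Submodule ℂ V :=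
  ⨆ μ ∈ S, Module.End.eigenspace T (μ : ℂ)

theorem spectralProjector_eq {V : Type*} [NormedAddCommGroup V] [InnerProductSpace ℂ V]
    [FiniteDimensional ℂ V] (T : V →ₗ[ℂ] V) (S : Set ℝ) :
    spectralProjector T S = (spectralSpace T S).starProjection := rfl

/-- The positive spectral subspace of `w · L`. -/
abbrev posSpace (n : ℕ) (w : Fin 3 → ℝ) : Submodule ℂ (SpinRep n) :=
  spectralSpace (V := SpinRep n) (boostOp n w) (Set.Ioi 0)

theorem coherent_mem_posSpace {n : ℕ} (hn : 0 < n) {w : Fin 3 → ℝ} {u : Spinor} {l : ℝ}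
    (hl : 0 < l) (h : act (pauliVec w) u = (l : ℂ) • u) : coherent n u ∈ posSpace n w := by
  have hμ : (n : ℝ) / 2 * l ∈ Set.Ioi (0 : ℝ) := by
    have : (0 : ℝ) < n := by exact_mod_cast hn
    exact Set.mem_Ioi.2 (by positivity)
  refine Submodule.mem_iSup_of_mem _ (Submodule.mem_iSup_of_mem hμ ?_)
  rw [Module.End.mem_eigenspace_iff, boostOp_coherent n w h]
  push_cast
  rfl

/-- Eigenvectors of a symmetric operator with distinct real eigenvalues are orthogonal. The case `l
= 0` is included so that `w = 0` can be ruled out later. -/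
theorem inner_eq_zero_of_mem_posSpace {n : ℕ} {w : Fin 3 → ℝ} {f g : SpinRep n} {l : ℝ}
    (hl : l ≤ 0) (hf : boostOp n w f = (l : ℂ) • f) (hg : g ∈ posSpace n w) :
    inner ℂ f g = 0 := by
  have hle : posSpace n w ≤ (ℂ ∙ f)ᗮ := by
    refine iSup₂_le fun μ hμ g hg => ?_
    rw [Submodule.mem_orthogonal_singleton_iff_inner_right]
    rw [Module.End.mem_eigenspace_iff] at hg
    have h := boostOp_symm n w f g
    rw [hf, hg] at h
    have h1 := (inner_smul_left (𝕜 := ℂ) f g (l : ℂ)).symm.trans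
      (h.trans (inner_smul_right (𝕜 := ℂ) f g (μ : ℂ)))
    rw [Complex.conj_ofReal] at h1
    have h2 : ((l - μ : ℝ) : ℂ) * inner ℂ f g = 0 := by
      push_cast
      linear_combination h1
    refine (mul_eq_zero.1 h2).resolve_left ?_
    have h3 : l - μ < 0 := by linarith [Set.mem_Ioi.1 hμ]
    exact_mod_cast h3.ne
  exact Submodule.mem_orthogonal_singleton_iff_inner_right.1 (hle hg)

/-- A coherent state in the positive spectral subspace comes from a highest weight spinor. -/
theorem act_pauliVec_of_mem_posSpace {n : ℕ} (hn : 0 < n) {w : Fin 3 → ℝ} {u : Spinor}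
    (h : coherent n u ∈ posSpace n w) : act (pauliVec w) u = (len w : ℂ) • u := by
  -- Up to scale, `v` is the component of `u` in the negative eigenspace. Its tensor power is
  -- orthogonal to the positive spectral space, so `⟨v, u⟩ ^ n = 0`.
  set v := act (pauliVec w) u - (len w : ℂ) • u with hv
  have h1 : act (pauliVec w) v = (-(len w) : ℂ) • v := by
    rw [hv, act_sub, pauliVec_act_act, act_smul]
    module
  have h2 : inner ℂ v u = (0 : ℂ) := by
    have h3 := boostOp_coherent n w h1
    have h4 : boostOp n w (coherent n v) = (((n : ℝ) / 2 * -len w : ℝ) : ℂ) • coherent n v := by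
      rw [h3]
      push_cast
      rfl
    have hle : (n : ℝ) / 2 * -len w ≤ 0 := by
      have := len_nonneg w
      have h0 : (0 : ℝ) ≤ n := Nat.cast_nonneg n
      nlinarith [mul_nonneg h0 this]
    have h5 := inner_eq_zero_of_mem_posSpace hle h4 h
    rw [inner_coherent] at h5
    exact pow_eq_zero_iff hn.ne' |>.1 h5
  -- Moving `w · σ` to the left factor gives `⟨v, v⟩ = -2 len w ⟨v, u⟩`.
  have h6 : inner ℂ v v = (0 : ℂ) := by
    conv_lhs => rw [hv]
    rw [inner_sub_right, inner_act_right, conjTranspose_pauliVec, h1, inner_smul_left,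
      inner_smul_right, h2]
    simp
  exact sub_eq_zero.1 (inner_self_eq_zero.1 h6)

/-- The residual `y - Πy` is orthogonal to the range, so `a` may be subtracted from `x` for free,
and its norm is the distance from `y` to the range. The bound is a product of two small factors and
requires no regularity of the projector. -/
theorem norm_inner_sub_spectralProjector_le {V : Type*} [NormedAddCommGroup V]
    [InnerProductSpace ℂ V] [FiniteDimensional ℂ V] (T : V →ₗ[ℂ] V) (S : Set ℝ) (x y : V) {a b : V}
    (ha : a ∈ spectralSpace T S) (hb : b ∈ spectralSpace T S) :
    ‖(inner ℂ x y - inner ℂ x (spectralProjector T S y) : ℂ)‖ ≤ ‖x - a‖ * ‖y - b‖ := by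
  rw [spectralProjector_eq]
  set K := spectralSpace T S
  have h1 : (inner ℂ x y - inner ℂ x (K.starProjection y) : ℂ) =
      inner ℂ (x - a) (y - K.starProjection y) := by
    have : inner ℂ a (y - K.starProjection y) = (0 : ℂ) :=
      K.sub_starProjection_mem_orthogonal y a ha
    rw [inner_sub_left, this, inner_sub_right, sub_zero]
  rw [h1]
  refine (norm_inner_le_norm _ _).trans (mul_le_mul_of_nonneg_left ?_ (norm_nonneg _))
  rw [Submodule.starProjection_minimal]
  exact ciInf_le ⟨0, by rintro _ ⟨z, rfl⟩; exact norm_nonneg _⟩ (⟨b, hb⟩ : K)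

/-! ### First-order behaviour of projected coherent states -/

theorem differentiableAt_coherent (n : ℕ) {u : ℝ → Spinor} {t : ℝ} (hu : DifferentiableAt ℝ u t) :
    DifferentiableAt ℝ (fun s => (coherent n (u s) : TensorPow n)) t := by
  rw [differentiableAt_piLp] at hu ⊢
  intro s
  simp only [coherent]
  exact DifferentiableAt.fun_finsetProd fun i _ => hu (s i)

theorem isBigO_coherent_sub (n : ℕ) {u v : ℝ → Spinor} (hu : DifferentiableAt ℝ u 0)
    (hv : DifferentiableAt ℝ v 0) (h0 : u 0 = v 0) :
    (fun t => ‖coherent n (u t) - coherent n (v t)‖) =O[nhds 0] fun t : ℝ => t := by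
  have hd := ((differentiableAt_coherent n hu).sub (differentiableAt_coherent n hv)).isBigO_sub
  simp only [Pi.sub_apply, h0, sub_self, sub_zero] at hd
  exact hd.norm_left

theorem differentiableAt_pauliVec_act {w : ℝ → Fin 3 → ℝ} {u : ℝ → Spinor}
    (hw : ∀ i, DifferentiableAt ℝ (fun t => w t i) 0) (hu : DifferentiableAt ℝ u 0) :
    DifferentiableAt ℝ (fun t => act (pauliVec (w t)) (u t)) 0 := by
  have hw' : ∀ i, DifferentiableAt ℝ (fun t => ((w t i : ℝ) : ℂ)) 0 := fun i =>
    Complex.ofRealCLM.differentiableAt.comp 0 (hw i)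
  have h0 := hw' 0
  have h1 := hw' 1
  have h2 := hw' 2
  rw [differentiableAt_piLp] at hu ⊢
  have hu0 := hu 0
  have hu1 := hu 1
  intro i
  fin_cases i <;>
  · simp [pauliVec_eq]
    fun_prop

theorem differentiableAt_len {w : ℝ → Fin 3 → ℝ}
    (hw : ∀ i, DifferentiableAt ℝ (fun t => w t i) 0) (h0 : w 0 ≠ 0) :
    DifferentiableAt ℝ (fun t => len (w t)) 0 := by
  refine DifferentiableAt.sqrt (DifferentiableAt.fun_sum fun i _ => (hw i).pow 2) ?_
  rw [← len_sq]
  exact (pow_pos (len_pos h0) 2).ne'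

/-- First-order behaviour of the projected coherent state amplitude at a point where the coherent
state lies in the positive spectral subspace: only the variation of the bra contributes. -/
theorem hasDerivAt_projected {n : ℕ} (hn : 0 < n) {w : ℝ → Fin 3 → ℝ} {h : ℝ → Spinor}
    {h' ξ : Spinor} {l : ℂ} (hw : ∀ i, DifferentiableAt ℝ (fun t => w t i) 0) (hw0 : w 0 ≠ 0)
    (hh : HasDerivAt h h' 0) (hξ : act (pauliVec (w 0)) ξ = (len (w 0) : ℂ) • ξ)
    (h0 : h 0 = l • ξ) :
    HasDerivAt (fun t => (inner ℂ (coherent n (h t))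
        (spectralProjector (boostOp n (w t)) (Set.Ioi 0) (coherent n ξ)) : ℂ))
      ((n : ℂ) * inner ℂ (h 0) ξ ^ (n - 1) * inner ℂ h' ξ) 0 := by
  -- An eigenspinor `x` at time `0` extends to a differentiable curve of eigenspinors: apply `w · σ
  -- + len w` and divide by its eigenvalue `2 len w` at time `0`.
  have key : ∀ x : Spinor, act (pauliVec (w 0)) x = (len (w 0) : ℂ) • x →
      ∃ p : ℝ → Spinor, DifferentiableAt ℝ p 0 ∧ p 0 = x ∧
        ∀ᶠ t in nhds 0, coherent n (p t) ∈ posSpace n (w t) := by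
    intro x hx
    have hl0 : ((2 * len (w 0) : ℝ) : ℂ) ≠ 0 := by
      have := len_pos hw0
      exact_mod_cast (by positivity : (2 * len (w 0)) ≠ 0)
    refine ⟨fun t => ((2 * len (w 0) : ℝ) : ℂ)⁻¹ • (act (pauliVec (w t)) x + (len (w t) : ℂ) • x),
      ?_, ?_, ?_⟩
    · refine DifferentiableAt.const_smul (R := ℂ) (DifferentiableAt.add
        (differentiableAt_pauliVec_act hw (differentiableAt_const x)) ?_) _
      exact DifferentiableAt.smul_const
        (Complex.ofRealCLM.differentiableAt.comp 0 (differentiableAt_len hw hw0)) x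
    · simp only []
      rw [hx, ← add_smul, smul_smul]
      rw [show (len (w 0) : ℂ) + len (w 0) = ((2 * len (w 0) : ℝ) : ℂ) by push_cast; ring,
        inv_mul_cancel₀ hl0, one_smul]
    · have hev : ∀ᶠ t in nhds (0 : ℝ), 0 < len (w t) :=
        (differentiableAt_len hw hw0).continuousAt.eventually (lt_mem_nhds (len_pos hw0))
      filter_upwards [hev] with t ht
      refine coherent_mem_posSpace hn ht ?_
      rw [act_smul, pauliVec_act_proj, smul_comm]
  obtain ⟨p, hp, hp0, hpm⟩ := key ξ hξ
  obtain ⟨q, hq, hq0, hqm⟩ := key (h 0) (by rw [h0, act_smul, hξ, smul_comm])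
  set r : ℝ → ℂ := fun t => inner ℂ (coherent n (h t)) (coherent n ξ) -
    inner ℂ (coherent n (h t)) (spectralProjector (boostOp n (w t)) (Set.Ioi 0) (coherent n ξ))
    with hr
  have hbound : ∀ᶠ t in nhds (0 : ℝ), ‖r t‖ ≤
      ‖‖coherent n (h t) - coherent n (q t)‖ * ‖coherent n ξ - coherent n (p t)‖‖ := by
    filter_upwards [hpm, hqm] with t h1 h2
    rw [Real.norm_of_nonneg (by positivity)]
    exact norm_inner_sub_spectralProjector_le _ _ _ _ h2 h1
  -- Both distances are `O(t)`, since the curves agree at time `0`; the error `r` is therefore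
  -- `O(t²)` and does not contribute to the derivative.
  have hO := (Asymptotics.IsBigO.of_bound' hbound).trans
    ((isBigO_coherent_sub n hh.differentiableAt hq hq0.symm).mul
      (isBigO_coherent_sub n (differentiableAt_const ξ) hp hp0.symm))
  have hr0 : r 0 = 0 := by
    simpa using hO.eq_zero_imp.self_of_nhds (by simp)
  have hrd : HasDerivAt r 0 0 := by
    rw [hasDerivAt_iff_isLittleO]
    simp only [hr0, sub_zero, smul_zero]
    refine hO.trans_isLittleO ?_
    have := (Asymptotics.isLittleO_one_iff ℝ (l := nhds (0 : ℝ))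
      (f := fun t : ℝ => t)).2 Filter.tendsto_id
    simpa using this.mul_isBigO (Asymptotics.isBigO_refl (fun t : ℝ => t) _)
  have hmain : HasDerivAt (fun t => (inner ℂ (coherent n (h t)) (coherent n ξ) : ℂ))
      ((n : ℂ) * inner ℂ (h 0) ξ ^ (n - 1) * inner ℂ h' ξ) 0 := by
    simp only [inner_coherent]
    have h1 := (hh.inner ℂ (hasDerivAt_const (0 : ℝ) ξ))
    simp only [inner_zero_right, zero_add] at h1
    exact h1.pow n
  have := hmain.sub hrd
  rw [sub_zero] at this
  refine this.congr_of_eventuallyEq (Filter.Eventually.of_forall fun t => ?_)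
  simp [hr]

/-! ### Maximality of the real part -/

theorem norm_inner_div_le {u v : Spinor} (hu : ‖u‖ = 1) : ‖(inner ℂ v u : ℂ)‖ / ‖v‖ ≤ 1 := by
  refine div_le_one_of_le₀ ?_ (norm_nonneg _)
  simpa [hu] using norm_inner_le_norm (𝕜 := ℂ) v u

theorem norm_inner_div_eq_one_iff {u v : Spinor} (hu : ‖u‖ = 1) (hv : v ≠ 0) :
    ‖(inner ℂ v u : ℂ)‖ / ‖v‖ = 1 ↔ ∃ α : ℂ, u = α • v := by
  have hv' := norm_ne_zero_iff.2 hv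
  rw [div_eq_one_iff_eq hv']
  have h := norm_inner_eq_norm_iff (𝕜 := ℂ) hv (ne_zero_of_norm_one hu)
  rw [hu, mul_one] at h
  rw [h]
  constructor
  · rintro ⟨r, -, hr⟩
    exact ⟨r, hr⟩
  · rintro ⟨r, hr⟩
    refine ⟨r, ?_, hr⟩
    rintro rfl
    exact ne_zero_of_norm_one hu (by simpa using hr)

/-- Normalization of `u` forces `‖α‖ = 1 / ‖v‖`, which leaves only the argument of `α`. -/
theorem exists_phase {u v : Spinor} (hu : ‖u‖ = 1) (hv : v ≠ 0) {α : ℂ} (h : u = α • v) :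
    ∃ φ : ℝ, u = (Complex.exp (Complex.I * φ) / (‖v‖ : ℂ)) • v := by
  refine ⟨α.arg, ?_⟩
  have hv' : (‖v‖ : ℂ) ≠ 0 := by exact_mod_cast norm_ne_zero_iff.2 hv
  have h1 : (‖α‖ : ℂ) * ‖v‖ = 1 := by
    rw [h, norm_smul] at hu
    exact_mod_cast hu
  have h2 := Complex.norm_mul_exp_arg_mul_I α
  rw [h]
  congr 1
  rw [eq_div_iff hv', mul_comm Complex.I]
  linear_combination Complex.exp (α.arg * Complex.I) * h1 - ‖v‖ * h2

theorem Configuration.Zab_ne (c : Configuration) (e : Triangle) : c.Zab e ≠ 0 :=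
  act_inv_ne_zero _ (c.z_ne e)

theorem Configuration.Zba_ne (c : Configuration) (e : Triangle) : c.Zba e ≠ 0 :=
  act_inv_ne_zero _ (c.z_ne e)

theorem BoundaryData.norm_ξ_ab (B : BoundaryData) (e : Triangle) : ‖B.ξ e.a e.b‖ = 1 :=
  B.ξ_unit _ _ (ne_of_lt e.2)

theorem BoundaryData.norm_ξ_ba (B : BoundaryData) (e : Triangle) : ‖B.ξ e.b e.a‖ = 1 :=
  B.ξ_unit _ _ (ne_of_gt e.2)

theorem BoundaryData.twoSpin_pos' (B : BoundaryData) (e : Triangle) : 0 < B.twoSpin e.a e.b :=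
  B.twoSpin_pos _ _ (ne_of_lt e.2)

theorem BoundaryData.spin_pos (B : BoundaryData) (e : Triangle) : 0 < B.spin e.a e.b := by
  have : (0 : ℝ) < B.twoSpin e.a e.b := by exact_mod_cast B.twoSpin_pos' e
  rw [BoundaryData.spin]
  positivity

/-- The maximality equations up to normalization and phase. -/
def Aligned (B : BoundaryData) (c : Configuration) (e : Triangle) : Prop :=
  (∃ α : ℂ, B.ξ e.a e.b = α • c.Zab e) ∧ ∃ α : ℂ, J (hat (c.η e)) = α • c.Zba e

theorem norm_J_hat (c : Configuration) (e : Triangle) : ‖J (hat (c.η e))‖ = 1 := by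
  rw [norm_J, norm_hat (c.η_ne e)]

theorem maxEquation_iff_aligned (B : BoundaryData) (c : Configuration) (e : Triangle) :
    MaxEquation B c e ↔ Aligned B c e := by
  constructor
  · rintro ⟨φ, φ', h1, h2⟩
    exact ⟨⟨_, h1⟩, ⟨_, h2⟩⟩
  · rintro ⟨⟨α, h1⟩, ⟨α', h2⟩⟩
    obtain ⟨φ, h3⟩ := exists_phase (B.norm_ξ_ab e) (c.Zab_ne e) h1
    obtain ⟨φ', h4⟩ := exists_phase (norm_J_hat c e) (c.Zba_ne e) h2
    exact ⟨φ, φ', h3, h4⟩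

theorem norm_eprlArg (B : BoundaryData) (c : Configuration) (e : Triangle) :
    ‖eprlArg B c e‖ = (‖(inner ℂ (c.Zab e) (B.ξ e.a e.b) : ℂ)‖ / ‖c.Zab e‖ *
      (‖(inner ℂ (c.Zba e) (J (hat (c.η e))) : ℂ)‖ / ‖c.Zba e‖)) ^ 2 := by
  rw [eprlArg, norm_div, norm_mul, norm_mul, norm_pow, norm_pow, norm_inner_symm (J _) _,
    inner_self_eq_norm_sq_to_K, inner_self_eq_norm_sq_to_K]
  simp only [norm_pow, RCLike.norm_ofReal, abs_norm]
  rw [div_mul_div_comm, div_pow, mul_pow, mul_pow]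

theorem norm_eprlArg_le_one (B : BoundaryData) (c : Configuration) (e : Triangle) :
    ‖eprlArg B c e‖ ≤ 1 := by
  rw [norm_eprlArg]
  refine pow_le_one₀ (by positivity) (mul_le_one₀ (norm_inner_div_le (B.norm_ξ_ab e))
    (by positivity) (norm_inner_div_le (norm_J_hat c e)))

theorem norm_eprlArg_eq_one_iff (B : BoundaryData) (c : Configuration) (e : Triangle) :
    ‖eprlArg B c e‖ = 1 ↔ Aligned B c e := by
  rw [norm_eprlArg, pow_eq_one_iff_of_nonneg (by positivity) two_ne_zero, Aligned,
    ← norm_inner_div_eq_one_iff (B.norm_ξ_ab e) (c.Zab_ne e),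
    ← norm_inner_div_eq_one_iff (norm_J_hat c e) (c.Zba_ne e)]
  have hx := norm_inner_div_le (v := c.Zab e) (B.norm_ξ_ab e)
  have hy := norm_inner_div_le (v := c.Zba e) (norm_J_hat c e)
  have hx0 : 0 ≤ ‖(inner ℂ (c.Zab e) (B.ξ e.a e.b) : ℂ)‖ / ‖c.Zab e‖ := by positivity
  have hy0 : 0 ≤ ‖(inner ℂ (c.Zba e) (J (hat (c.η e))) : ℂ)‖ / ‖c.Zba e‖ := by positivity
  constructor
  -- Two numbers in `[0, 1]` with product `1` are both `1`.
  · intro h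
    constructor <;> nlinarith
  · rintro ⟨h1, h2⟩
    rw [h1, h2, one_mul]

theorem branchLog_self_re (w : ℂ) : (branchLog w w).re = Real.log ‖w‖ := by
  rw [branchLog, Complex.add_re, Complex.log_re]
  by_cases h : w = 0
  -- At `w = 0` both sides are `0`, by the conventions `log 0 = 0` and `0 / 0 = 0`.
  · simp [h]
  · rw [div_self h]
    simp

theorem re_eprlAction_self (B : BoundaryData) (γ : ℝ) (c : Configuration) :
    (eprlAction B γ c c).re = ∑ e : Triangle, B.spin e.a e.b * Real.log ‖eprlArg B c e‖ := by
  rw [eprlAction, Complex.re_sum]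
  refine Finset.sum_congr rfl fun e _ => ?_
  -- The `γ`-term is `i` times a real number, because its logarithm has a positive argument.
  have h : Complex.log (inner ℂ (c.Zba e) (c.Zba e) / inner ℂ (c.Zab e) (c.Zab e)) =
      (Real.log (‖c.Zba e‖ ^ 2 / ‖c.Zab e‖ ^ 2) : ℂ) := by
    rw [Complex.ofReal_log (by positivity), inner_self_eq_norm_sq_to_K,
      inner_self_eq_norm_sq_to_K]
    push_cast
    rfl
  rw [Complex.add_re, Complex.re_ofReal_mul, branchLog_self_re, h]
  simp [Complex.mul_re, Complex.mul_im]

theorem re_eprlAction_self_le (B : BoundaryData) (γ : ℝ) (c : Configuration) :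
    (eprlAction B γ c c).re ≤ 0 := by
  rw [re_eprlAction_self]
  refine Finset.sum_nonpos fun e _ => ?_
  exact mul_nonpos_of_nonneg_of_nonpos (B.spin_pos e).le
    (Real.log_nonpos (norm_nonneg _) (norm_eprlArg_le_one B c e))

/-- Because `Real.log 0 = 0`, the domain condition is needed here to exclude vanishing arguments. -/
theorem norm_eq_one_of_log_eq_zero {w : ℂ} (hw : w ≠ 0) (h : Real.log ‖w‖ = 0) : ‖w‖ = 1 :=
  Real.eq_one_of_pos_of_log_eq_zero (norm_pos_iff.2 hw) h

theorem aligned_of_re_eprlAction (B : BoundaryData) (γ : ℝ) (c : Configuration)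
    (h0 : ∀ e, eprlArg B c e ≠ 0) (h : (eprlAction B γ c c).re = 0) (e : Triangle) :
    Aligned B c e := by
  rw [re_eprlAction_self] at h
  have h1 := (Finset.sum_eq_zero_iff_of_nonpos fun e _ =>
    mul_nonpos_of_nonneg_of_nonpos (B.spin_pos e).le
      (Real.log_nonpos (norm_nonneg _) (norm_eprlArg_le_one B c e))).1 h e (Finset.mem_univ e)
  exact (norm_eprlArg_eq_one_iff B c e).1 (norm_eq_one_of_log_eq_zero (h0 e)
    ((mul_eq_zero.1 h1).resolve_left (B.spin_pos e).ne'))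

theorem re_eprlAction_of_aligned (B : BoundaryData) (γ : ℝ) (c : Configuration)
    (h : ∀ e, Aligned B c e) : (eprlAction B γ c c).re = 0 := by
  rw [re_eprlAction_self]
  refine Finset.sum_eq_zero fun e _ => ?_
  rw [(norm_eprlArg_eq_one_iff B c e).2 (h e), Real.log_one, mul_zero]

theorem eprlArg_ne_zero_of_aligned {B : BoundaryData} {c : Configuration} {e : Triangle}
    (h : Aligned B c e) : eprlArg B c e ≠ 0 := by
  rw [← norm_ne_zero_iff, (norm_eprlArg_eq_one_iff B c e).2 h]
  exact one_ne_zero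

/-! ### The projector amplitude -/

/-- The vector `β_ab v_ab`. -/
def properVec (X : Fin 5 → SL2C) (a b : Fin 5) (i : Fin 3) : ℝ := β X a b * boostVec X a b i

theorem projArg_eq (B : BoundaryData) (c : Configuration) (e : Triangle) :
    projArg B c e = inner ℂ (coherent (B.twoSpin e.a e.b) (hat (c.η e)))
      (spectralProjector (V := SpinRep (B.twoSpin e.a e.b))
        (boostOp (B.twoSpin e.a e.b) (properVec c.X e.b e.a)) (Set.Ioi 0)
        (coherent (B.twoSpin e.a e.b) (B.ξ e.b e.a))) := rfl

/-- `C_{ξ_ba}` is non-zero and is a highest weight vector along `β_ba v_ba`. -/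
def HighestWeight (B : BoundaryData) (X : Fin 5 → SL2C) (e : Triangle) : Prop :=
  properVec X e.b e.a ≠ 0 ∧
    act (pauliVec (properVec X e.b e.a)) (B.ξ e.b e.a) =
      (len (properVec X e.b e.a) : ℂ) • B.ξ e.b e.a

theorem norm_spectralProjector_le {V : Type*} [NormedAddCommGroup V] [InnerProductSpace ℂ V]
    [FiniteDimensional ℂ V] (T : V →ₗ[ℂ] V) (S : Set ℝ) (y : V) :
    ‖spectralProjector T S y‖ ≤ ‖y‖ :=
  Submodule.norm_starProjection_apply_le _ y

/-- Cauchy-Schwarz gives `1 ≤ ‖Πy‖ ≤ ‖y‖ = 1`, and an orthogonal projection preserves the norm only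
of vectors in its range. -/
theorem mem_spectralSpace_of_norm_eq {V : Type*} [NormedAddCommGroup V] [InnerProductSpace ℂ V]
    [FiniteDimensional ℂ V] (T : V →ₗ[ℂ] V) (S : Set ℝ) (x y : V) (hx : ‖x‖ = 1) (hy : ‖y‖ = 1)
    (h : ‖(inner ℂ x (spectralProjector T S y) : ℂ)‖ = 1) : y ∈ spectralSpace T S := by
  have h1 := norm_inner_le_norm (𝕜 := ℂ) x (spectralProjector T S y)
  rw [h, hx, one_mul] at h1
  have h2 := norm_spectralProjector_le T S y
  rw [Submodule.mem_iff_norm_starProjection, ← spectralProjector_eq]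
  linarith

theorem spectralProjector_apply_of_mem {V : Type*} [NormedAddCommGroup V] [InnerProductSpace ℂ V]
    [FiniteDimensional ℂ V] {T : V →ₗ[ℂ] V} {S : Set ℝ} {y : V} (h : y ∈ spectralSpace T S) :
    spectralProjector T S y = y :=
  Submodule.starProjection_eq_self_iff.2 h

theorem norm_projArg_le_one (B : BoundaryData) (c : Configuration) (e : Triangle) :
    ‖projArg B c e‖ ≤ 1 := by
  rw [projArg_eq]
  refine (norm_inner_le_norm (𝕜 := ℂ) (E := SpinRep (B.twoSpin e.a e.b)) _ _).trans ?_
  rw [norm_coherent _ (norm_hat (c.η_ne e)), one_mul]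
  exact (norm_spectralProjector_le (V := SpinRep _) _ _ _).trans (norm_coherent _ (B.norm_ξ_ba e)).le

/-- For `w = 0` the operator vanishes, so the coherent state would be orthogonal to itself. -/
theorem ne_zero_of_mem_posSpace {n : ℕ} {w : Fin 3 → ℝ} {u : Spinor} (hu : ‖u‖ = 1)
    (h : coherent n u ∈ posSpace n w) : w ≠ 0 := by
  rintro rfl
  have h1 : act (pauliVec 0) u = (0 : ℂ) • u := by
    rw [pauliVec_eq]
    apply spinor_ext <;> simp
  have h2 : boostOp n 0 (coherent n u) = ((0 : ℝ) : ℂ) • coherent n u := by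
    rw [boostOp_coherent n 0 h1]
    simp
  have h3 := inner_eq_zero_of_mem_posSpace le_rfl h2 h
  rw [inner_coherent, inner_self_of_norm_one hu] at h3
  simp at h3

theorem norm_projArg_eq_one_iff (B : BoundaryData) (c : Configuration) (e : Triangle) :
    ‖projArg B c e‖ = 1 ↔
      HighestWeight B c.X e ∧ ∃ l : ℂ, hat (c.η e) = l • B.ξ e.b e.a := by
  have hn := B.twoSpin_pos' e
  have hη := norm_hat (c.η_ne e)
  have hξ := B.norm_ξ_ba e
  -- Once `C_ξ` is in the range the projector drops out, and the amplitude is a power of `⟨η̂, ξ⟩`.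
  have hpar : ∀ hmem : coherent (B.twoSpin e.a e.b) (B.ξ e.b e.a) ∈
      posSpace (B.twoSpin e.a e.b) (properVec c.X e.b e.a),
      ‖projArg B c e‖ = 1 ↔ ∃ l : ℂ, hat (c.η e) = l • B.ξ e.b e.a := by
    intro hmem
    rw [projArg_eq, spectralProjector_apply_of_mem hmem, inner_coherent, norm_pow,
      pow_eq_one_iff_of_nonneg (norm_nonneg _) hn.ne', norm_inner_symm,
      ← norm_inner_div_eq_one_iff hη (ne_zero_of_norm_one hξ), hξ, div_one]
  constructor
  · intro h
    have hmem : coherent (B.twoSpin e.a e.b) (B.ξ e.b e.a) ∈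
        posSpace (B.twoSpin e.a e.b) (properVec c.X e.b e.a) := by
      rw [projArg_eq] at h
      exact mem_spectralSpace_of_norm_eq _ _ _ _ (norm_coherent _ hη) (norm_coherent _ hξ) h
    exact ⟨⟨ne_zero_of_mem_posSpace hξ hmem, act_pauliVec_of_mem_posSpace hn hmem⟩,
      (hpar hmem).1 h⟩
  · rintro ⟨⟨h1, h2⟩, h3⟩
    exact (hpar (coherent_mem_posSpace hn (len_pos h1) h2)).2 h3

theorem re_projAction_self (B : BoundaryData) (c : Configuration) :
    (projAction B c c).re = ∑ e : Triangle, Real.log ‖projArg B c e‖ := by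
  rw [projAction, Complex.re_sum]
  exact Finset.sum_congr rfl fun e _ => branchLog_self_re _

theorem re_projAction_self_le (B : BoundaryData) (c : Configuration) :
    (projAction B c c).re ≤ 0 := by
  rw [re_projAction_self]
  exact Finset.sum_nonpos fun e _ => Real.log_nonpos (norm_nonneg _) (norm_projArg_le_one B c e)

theorem norm_projArg_of_re (B : BoundaryData) (c : Configuration)
    (h0 : ∀ e, projArg B c e ≠ 0) (h : (projAction B c c).re = 0) (e : Triangle) :
    ‖projArg B c e‖ = 1 := by
  rw [re_projAction_self] at h
  exact norm_eq_one_of_log_eq_zero (h0 e) ((Finset.sum_eq_zero_iff_of_nonpos fun e _ =>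
    Real.log_nonpos (norm_nonneg _) (norm_projArg_le_one B c e)).1 h e (Finset.mem_univ e))

theorem re_projAction_of_norm (B : BoundaryData) (c : Configuration)
    (h : ∀ e, ‖projArg B c e‖ = 1) : (projAction B c c).re = 0 := by
  rw [re_projAction_self]
  exact Finset.sum_eq_zero fun e _ => by rw [h e, Real.log_one]

/-! ### Change of representatives -/

theorem Point.rep_toPoint (P : Point) : P.rep.toPoint = P := by
  simp [Point.rep, Configuration.toPoint, Projectivization.mk_rep]

/-- A variation brings its own representatives at time `0`; they differ from `P.rep` by non-zero
scalars, under which the conditions below are invariant. -/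
theorem rep_of_toPoint {P : Point} {c : Configuration} (h : c.toPoint = P) :
    c.X = P.X ∧ (∀ e, ∃ a : ℂ, a ≠ 0 ∧ c.z e = a • P.rep.z e) ∧
      ∀ e, ∃ a : ℂ, a ≠ 0 ∧ c.η e = a • P.rep.η e := by
  subst h
  refine ⟨rfl, fun e => ?_, fun e => ?_⟩
  · obtain ⟨a, ha⟩ := (Projectivization.mk_eq_mk_iff' ℂ _ _ (c.z_ne e)
      (c.toPoint.rep.z_ne e)).1 (Projectivization.mk_rep (c.toPoint.z e)).symm
    exact ⟨a, fun h0 => c.z_ne e (by rw [← ha, h0, zero_smul]), ha.symm⟩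
  · obtain ⟨a, ha⟩ := (Projectivization.mk_eq_mk_iff' ℂ _ _ (c.η_ne e)
      (c.toPoint.rep.η_ne e)).1 (Projectivization.mk_rep (c.toPoint.η e)).symm
    exact ⟨a, fun h0 => c.η_ne e (by rw [← ha, h0, zero_smul]), ha.symm⟩

theorem hat_parallel {u v : Spinor} {a : ℂ} (hu : u ≠ 0) (h : u = a • v) :
    ∃ l : ℂ, l ≠ 0 ∧ hat u = l • v := by
  refine ⟨((‖u‖⁻¹ : ℝ) : ℂ) * a, ?_, by rw [hat, h, smul_smul, ← h]⟩
  have ha : a ≠ 0 := by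
    rintro rfl
    exact hu (by simpa using h)
  have hu' : ((‖u‖⁻¹ : ℝ) : ℂ) ≠ 0 := by
    exact_mod_cast inv_ne_zero (norm_ne_zero_iff.2 hu)
  exact mul_ne_zero hu' ha

theorem eq_norm_smul_hat {u : Spinor} (hu : u ≠ 0) : u = (‖u‖ : ℂ) • hat u := by
  have hu' : (‖u‖ : ℂ) ≠ 0 := by exact_mod_cast norm_ne_zero_iff.2 hu
  rw [hat, smul_smul]
  push_cast
  rw [mul_inv_cancel₀ hu', one_smul]

theorem Zab_of_smul {c d : Configuration} {e : Triangle} {a : ℂ} (hX : c.X = d.X)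
    (hz : c.z e = a • d.z e) : c.Zab e = a • d.Zab e := by
  rw [Configuration.Zab, Configuration.Zab, hX, hz, act_smul]

theorem Zba_of_smul {c d : Configuration} {e : Triangle} {a : ℂ} (hX : c.X = d.X)
    (hz : c.z e = a • d.z e) : c.Zba e = a • d.Zba e := by
  rw [Configuration.Zba, Configuration.Zba, hX, hz, act_smul]

theorem aligned_of_smul {B : BoundaryData} {c d : Configuration} {e : Triangle} {a b : ℂ}
    (ha : a ≠ 0) (hX : c.X = d.X) (hz : c.z e = a • d.z e) (hη : c.η e = b • d.η e)
    (h : Aligned B d e) : Aligned B c e := by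
  obtain ⟨⟨α, h1⟩, ⟨α', h2⟩⟩ := h
  refine ⟨⟨α * a⁻¹, ?_⟩, ?_⟩
  · rw [Zab_of_smul hX hz, smul_smul, mul_assoc, inv_mul_cancel₀ ha, mul_one, h1]
  · obtain ⟨l, -, hl⟩ := hat_parallel (c.η_ne e) hη
    refine ⟨star l * (‖d.η e‖ : ℂ) * α' * a⁻¹, ?_⟩
    rw [hl, eq_norm_smul_hat (d.η_ne e), J_smul, J_smul, h2, Zba_of_smul hX hz]
    simp only [smul_smul]
    congr 1
    rw [mul_assoc _ a⁻¹ a, inv_mul_cancel₀ ha, norm_smul, norm_hat (d.η_ne e)]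
    simp
    ring

/-! ### Calculus along a curve -/

theorem hasDerivAt_branchLog {w : ℝ → ℂ} {w' : ℂ} {t : ℝ} (hw : HasDerivAt w w' t)
    (h0 : w t ≠ 0) : HasDerivAt (fun s => branchLog (w t) (w s)) (w' / w t) t := by
  have h1 := (hw.div_const (w t)).clog_real (by rw [div_self h0]; exact Complex.one_mem_slitPlane)
  rw [div_self h0, div_one] at h1
  exact h1.const_add _

/-- `J` as a real linear map. -/
def JCLM : Spinor →L[ℝ] Spinor :=
  LinearMap.toContinuousLinearMap
    { toFun := J
      map_add' := J_add
      map_smul' := fun c u => by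
        have := J_smul (c : ℂ) u
        simpa using this }

theorem hasDerivAt_J {u : ℝ → Spinor} {u' : Spinor} {t : ℝ} (hu : HasDerivAt u u' t) :
    HasDerivAt (fun s => J (u s)) (J u') t :=
  JCLM.hasFDerivAt.comp_hasDerivAt t hu

theorem hasDerivAt_spinor_apply {u : ℝ → Spinor} {u' : Spinor} {t : ℝ} (hu : HasDerivAt u u' t)
    (i : Fin 2) : HasDerivAt (fun s => u s i) (u' i) t :=
  ((EuclideanSpace.proj (𝕜 := ℂ) (ι := Fin 2) i).restrictScalars
    ℝ).hasFDerivAt.comp_hasDerivAt t hu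

theorem hasDerivAt_spinor {u : ℝ → Spinor} {u' : Spinor} {t : ℝ}
    (h : ∀ i, HasDerivAt (fun s => u s i) (u' i) t) : HasDerivAt u u' t := by
  have hd : DifferentiableAt ℝ u t :=
    (differentiableAt_piLp (𝕜 := ℝ) 2).2 fun i => (h i).differentiableAt
  have h1 := hd.hasDerivAt
  have h2 : deriv u t = u' := by
    ext i
    exact (hasDerivAt_spinor_apply h1 i).unique (h i)
  rwa [h2] at h1

theorem hasDerivAt_act {M : ℝ → Matrix (Fin 2) (Fin 2) ℂ} {M' : Matrix (Fin 2) (Fin 2) ℂ}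
    {u : ℝ → Spinor} {u' : Spinor} {t : ℝ}
    (hM : ∀ i j, HasDerivAt (fun s => M s i j) (M' i j) t) (hu : HasDerivAt u u' t) :
    HasDerivAt (fun s => act (M s) (u s)) (act M' (u t) + act (M t) u') t := by
  have hu0 := hasDerivAt_spinor_apply hu 0
  have hu1 := hasDerivAt_spinor_apply hu 1
  refine hasDerivAt_spinor fun i => ?_
  fin_cases i
  · simp only [Fin.zero_eta, act_apply_zero, PiLp.add_apply]
    exact (((hM 0 0).mul hu0).add ((hM 0 1).mul hu1)).congr_deriv (by ring)
  · simp only [Fin.mk_one, act_apply_one, PiLp.add_apply]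
    exact (((hM 1 0).mul hu0).add ((hM 1 1).mul hu1)).congr_deriv (by ring)

theorem differentiableAt_hat {u : ℝ → Spinor} {t : ℝ} (hu : DifferentiableAt ℝ u t)
    (h0 : u t ≠ 0) : DifferentiableAt ℝ (fun s => hat (u s)) t := by
  have h1 : DifferentiableAt ℝ (fun s => ‖u s‖) t := hu.norm ℂ h0
  have h2 : DifferentiableAt ℝ (fun s => ((‖u s‖⁻¹ : ℝ) : ℂ)) t :=
    Complex.ofRealCLM.differentiableAt.comp t (h1.inv (norm_ne_zero_iff.2 h0))
  exact h2.smul hu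

/-- The real number `Im F + γ Re F`. -/
def phaseForm (γ : ℝ) (F : ℂ) : ℝ := F.im + γ * F.re

theorem phaseForm_sum {ι : Type*} (γ : ℝ) (s : Finset ι) (F : ι → ℂ) :
    phaseForm γ (∑ i ∈ s, F i) = ∑ i ∈ s, phaseForm γ (F i) := by
  simp only [phaseForm, Complex.im_sum, Complex.re_sum, Finset.mul_sum, Finset.sum_add_distrib]

theorem phaseForm_ofReal_mul (γ r : ℝ) (F : ℂ) : phaseForm γ (r * F) = r * phaseForm γ F := by
  simp only [phaseForm, Complex.im_ofReal_mul, Complex.re_ofReal_mul]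
  ring

/-- The two equations form a real linear system in `Re F`, `Im F` whose determinant is `1 + γ²` up
to sign. -/
theorem eq_zero_of_phaseForm {γ : ℝ} {F : ℂ} (h1 : phaseForm γ F = 0)
    (h2 : phaseForm γ (Complex.I * F) = 0) : F = 0 := by
  simp only [phaseForm, Complex.mul_re, Complex.mul_im, Complex.I_re, Complex.I_im] at h1 h2
  have h3 : F.re * (1 + γ ^ 2) = 0 := by linear_combination h2 + γ * h1
  have h4 : F.re = 0 := (mul_eq_zero.1 h3).resolve_right (by positivity)
  have h5 : F.im = 0 := by simpa [h4] using h1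
  exact Complex.ext h4 h5

/-- The logarithmic derivative of one summand of the EPRL action at a point where the Cauchy-Schwarz
inequalities are saturated. -/
theorem hasDerivAt_eprlTerm {u v h : ℝ → Spinor} {u' v' h' ξ : Spinor} {α α' : ℂ} (k γ : ℝ)
    (hu : HasDerivAt u u' 0) (hv : HasDerivAt v v' 0) (hh : HasDerivAt h h' 0)
    (hu0 : u 0 ≠ 0) (hv0 : v 0 ≠ 0) (hh1 : ‖h 0‖ = 1) (hα : α ≠ 0)
    (hξ : ξ = α • u 0) (hh0 : h 0 = α' • v 0) :
    HasDerivAt (fun t => (k : ℂ) * branchLog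
        (inner ℂ (u 0) ξ ^ 2 * inner ℂ (h 0) (v 0) ^ 2 /
          (inner ℂ (u 0) (u 0) * inner ℂ (v 0) (v 0)))
        (inner ℂ (u t) ξ ^ 2 * inner ℂ (h t) (v t) ^ 2 /
          (inner ℂ (u t) (u t) * inner ℂ (v t) (v t))) +
      Complex.I * (γ : ℂ) * (k : ℂ) *
        Complex.log (inner ℂ (v t) (v t) / inner ℂ (u t) (u t)))
      (2 * k * (Complex.I * (phaseForm γ (inner ℂ (v 0) v' / inner ℂ (v 0) (v 0) -
        inner ℂ (u 0) u' / inner ℂ (u 0) (u 0)) : ℂ) + inner ℂ h' (h 0))) 0 := by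
  have hα' : α' ≠ 0 := by
    rintro rfl
    exact ne_zero_of_norm_one hh1 (by simpa using hh0)
  have hN : ∀ x : Spinor, (inner ℂ x x : ℂ) = ((‖x‖ ^ 2 : ℝ) : ℂ) := fun x => by
    rw [inner_self_eq_norm_sq_to_K]
    push_cast
    rfl
  have hNu : (inner ℂ (u 0) (u 0) : ℂ) ≠ 0 := inner_self_ne_zero.2 hu0
  have hNv : (inner ℂ (v 0) (v 0) : ℂ) ≠ 0 := inner_self_ne_zero.2 hv0
  have hp : (inner ℂ (u 0) ξ : ℂ) = α * inner ℂ (u 0) (u 0) := by rw [hξ, inner_smul_right]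
  have hq : (inner ℂ (h 0) (v 0) : ℂ) = star α' * inner ℂ (v 0) (v 0) := by
    rw [hh0, inner_smul_left]
    rfl
  have hstar : star α' ≠ 0 := star_ne_zero.2 hα'
  have hp0 : (inner ℂ (u 0) ξ : ℂ) ≠ 0 := by rw [hp]; exact mul_ne_zero hα hNu
  have hq0 : (inner ℂ (h 0) (v 0) : ℂ) ≠ 0 := by rw [hq]; exact mul_ne_zero hstar hNv
  have dp := hu.inner ℂ (hasDerivAt_const (0 : ℝ) ξ)
  have dq := hh.inner ℂ hv
  have du := hu.inner ℂ hu
  have dv := hv.inner ℂ hv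
  have d1 := hasDerivAt_branchLog (((dp.pow 2).mul (dq.pow 2)).div (du.mul dv)
    (mul_ne_zero hNu hNv)) (by
      simp only [Pi.mul_apply, Pi.pow_apply, Pi.div_apply]
      exact div_ne_zero (mul_ne_zero (pow_ne_zero 2 hp0) (pow_ne_zero 2 hq0))
        (mul_ne_zero hNu hNv))
  have d2 := (dv.div du hNu).clog_real (by
    simp only [Pi.div_apply]
    rw [hN, hN, ← Complex.ofReal_div, Complex.ofReal_mem_slitPlane]
    have h1 := norm_pos_iff.2 hu0
    have h2 := norm_pos_iff.2 hv0
    positivity)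
  refine ((d1.const_mul (k : ℂ)).add (d2.const_mul (Complex.I * γ * k))).congr_deriv ?_
  have hcu : (inner ℂ u' (u 0) : ℂ) = star (inner ℂ (u 0) u') := (inner_conj_symm _ _).symm
  have hcv : (inner ℂ v' (v 0) : ℂ) = star (inner ℂ (v 0) v') := (inner_conj_symm _ _).symm
  have hh'v : (inner ℂ h' (h 0) : ℂ) = α' * inner ℂ h' (v 0) := by rw [hh0, inner_smul_right]
  have hunit : star α' * α' * inner ℂ (v 0) (v 0) = 1 := by
    have h1 := inner_self_of_norm_one hh1
    rw [hh0, inner_smul_left, inner_smul_right] at h1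
    rw [mul_assoc]
    exact h1
  have hu'ξ : (inner ℂ u' ξ : ℂ) = α * star (inner ℂ (u 0) u') := by
    rw [hξ, inner_smul_right, hcu]
  have hqv : (inner ℂ (h 0) v' : ℂ) = star α' * inner ℂ (v 0) v' := by
    rw [hh0, inner_smul_left]
    rfl
  -- The modulus and phase logarithms contribute `F - F̄ = 2i Im F`, and the `γ`-logarithm
  -- contributes `iγ (F + F̄) = 2iγ Re F`.
  have hphase : ∀ F : ℂ, (phaseForm γ F : ℂ) * Complex.I * 2 =
      F - star F + Complex.I * γ * (F + star F) := by
    intro F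
    apply Complex.ext <;> simp [phaseForm]
    ring
  have hAv : star (inner ℂ (v 0) (v 0) : ℂ) = inner ℂ (v 0) (v 0) := inner_conj_symm _ _
  have hAu : star (inner ℂ (u 0) (u 0) : ℂ) = inner ℂ (u 0) (u 0) := inner_conj_symm _ _
  have hph := hphase (inner ℂ (v 0) v' / inner ℂ (v 0) (v 0) -
        inner ℂ (u 0) u' / inner ℂ (u 0) (u 0))
  rw [star_sub, star_div₀, star_div₀, hAv, hAu] at hph
  simp only [Pi.mul_apply, Pi.pow_apply, Pi.div_apply, inner_zero_right, zero_add, hp, hq, hu'ξ,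
    hqv, hcu, hcv]
  have hh'v' : (inner ℂ h' (v 0) : ℂ) = star α' * inner ℂ (v 0) (v 0) * inner ℂ h' (h 0) := by
    rw [hh'v]
    linear_combination (-inner ℂ h' (v 0)) * hunit
  rw [hh'v']
  -- With the relations above recorded, inner products become independent symbols and the claim is
  -- an identity of rational functions.
  generalize (phaseForm γ (inner ℂ (v 0) v' / inner ℂ (v 0) (v 0) -
        inner ℂ (u 0) u' / inner ℂ (u 0) (u 0)) : ℂ) = p at *
  generalize (inner ℂ (u 0) (u 0) : ℂ) = A at *
  generalize (inner ℂ (v 0) (v 0) : ℂ) = C at *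
  generalize (inner ℂ (u 0) u' : ℂ) = x at *
  generalize (inner ℂ (v 0) v' : ℂ) = y at *
  generalize star x = x' at *
  generalize star y = y' at *
  generalize (inner ℂ h' (h 0) : ℂ) = z at *
  generalize star α' = a' at *
  rw [show (2 * k * (Complex.I * p + z) : ℂ) = k * (p * Complex.I * 2 + 2 * z) by ring, hph]
  push_cast
  field_simp
  ring

/-! ### Variations -/

theorem hasDerivAt_inv_act {X : ℝ → SL2C} {X' : Matrix (Fin 2) (Fin 2) ℂ} {z : ℝ → Spinor}
    {z' : Spinor}
    (hX : ∀ i j, HasDerivAt (fun t => (X t : Matrix (Fin 2) (Fin 2) ℂ) i j) (X' i j) 0)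
    (hz : HasDerivAt z z' 0) :
    HasDerivAt (fun t => act ((X t)⁻¹ : SL2C) (z t))
      (act ((X 0)⁻¹ : SL2C) z' - act (((X 0)⁻¹ : SL2C) * X') (act ((X 0)⁻¹ : SL2C) (z 0))) 0 := by
  -- In `SL(2)` the inverse is the adjugate, which is linear in the entries.
  have hinv : ∀ i j, HasDerivAt (fun t => (((X t)⁻¹ : SL2C) : Matrix (Fin 2) (Fin 2) ℂ) i j)
      (X'.adjugate i j) 0 := by
    intro i j
    simp only [Matrix.SpecialLinearGroup.coe_inv, Matrix.adjugate_fin_two]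
    fin_cases i <;> fin_cases j
    · exact hX 1 1
    · exact (hX 0 1).neg
    · exact (hX 1 0).neg
    · exact hX 0 0
  have h1 := hasDerivAt_act hinv hz
  refine h1.congr_deriv ?_
  -- Differentiating `X (X⁻¹ z) = z` replaces the derivative of the adjugate by `-X⁻¹ X' X⁻¹`.
  have h2 := hasDerivAt_act hX h1
  simp only [act_act_inv] at h2
  have h3 := h2.unique hz
  rw [← act_inv_act (X 0) (act X'.adjugate (z 0) + _), eq_sub_of_add_eq' h3, act_sub, act_mul]

/-- This is the derivative of `det X = 1`. -/
theorem trace_inv_mul_deriv {X : ℝ → SL2C} {X' : Matrix (Fin 2) (Fin 2) ℂ}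
    (hX : ∀ i j, HasDerivAt (fun t => (X t : Matrix (Fin 2) (Fin 2) ℂ) i j) (X' i j) 0) :
    Matrix.trace ((((X 0)⁻¹ : SL2C) : Matrix (Fin 2) (Fin 2) ℂ) * X') = 0 := by
  have h1 := ((hX 0 0).mul (hX 1 1)).sub ((hX 0 1).mul (hX 1 0))
  have h2 : HasDerivAt (fun t => (X t : Matrix (Fin 2) (Fin 2) ℂ).det) 0 0 := by
    simp only [Matrix.SpecialLinearGroup.det_coe]
    exact hasDerivAt_const _ _
  simp only [Matrix.det_fin_two] at h2
  have h3 := h1.unique h2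
  simp only [Matrix.SpecialLinearGroup.coe_inv, Matrix.adjugate_fin_two, Matrix.trace_fin_two,
    Matrix.mul_apply, Fin.sum_univ_two, Matrix.of_apply, Matrix.cons_val', Matrix.cons_val_zero,
    Matrix.cons_val_one, Matrix.cons_val_fin_one]
  linear_combination h3

/-- The velocity of `X_a` along a curve of configurations. -/
def velX (c : ℝ → Configuration) (a : Fin 5) : Matrix (Fin 2) (Fin 2) ℂ :=
  Matrix.of fun i j => deriv (fun t => ((c t).X a : Matrix (Fin 2) (Fin 2) ℂ) i j) 0

/-- The velocity of `z_ab` along a curve of configurations. -/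
def velz (c : ℝ → Configuration) (e : Triangle) : Spinor := deriv (fun t => (c t).z e) 0

/-- The logarithmic velocity `X_a⁻¹ X_a'` along a curve of configurations. -/
def gen (c : ℝ → Configuration) (a : Fin 5) : Matrix (Fin 2) (Fin 2) ℂ :=
  (((c 0).X a)⁻¹ : SL2C) * velX c a

/-- The velocity of `Z_ab`. -/
def velZab (c : ℝ → Configuration) (e : Triangle) : Spinor :=
  act (((c 0).X e.a)⁻¹ : SL2C) (velz c e) - act (gen c e.a) ((c 0).Zab e)

/-- The velocity of `Z_ba`. -/
def velZba (c : ℝ → Configuration) (e : Triangle) : Spinor :=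
  act (((c 0).X e.b)⁻¹ : SL2C) (velz c e) - act (gen c e.b) ((c 0).Zba e)

/-- The difference of the relative velocities of `Z_ba` and `Z_ab`. -/
def flow (c : ℝ → Configuration) (e : Triangle) : ℂ :=
  inner ℂ ((c 0).Zba e) (velZba c e) / inner ℂ ((c 0).Zba e) ((c 0).Zba e) -
    inner ℂ ((c 0).Zab e) (velZab c e) / inner ℂ ((c 0).Zab e) ((c 0).Zab e)

section Variation

variable {P : Point} {c : ℝ → Configuration}

theorem IsVariation.hasDerivAt_X (hc : IsVariation P c) (a : Fin 5) (i j : Fin 2) :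
    HasDerivAt (fun t => ((c t).X a : Matrix (Fin 2) (Fin 2) ℂ) i j) (velX c a i j) 0 :=
  (hc.diff_X a i j).hasDerivAt

theorem IsVariation.hasDerivAt_Zab (hc : IsVariation P c) (e : Triangle) :
    HasDerivAt (fun t => (c t).Zab e) (velZab c e) 0 :=
  hasDerivAt_inv_act (X := fun t => (c t).X e.a) (z := fun t => (c t).z e) (hc.hasDerivAt_X e.a) (hc.diff_z e).hasDerivAt

theorem IsVariation.hasDerivAt_Zba (hc : IsVariation P c) (e : Triangle) :
    HasDerivAt (fun t => (c t).Zba e) (velZba c e) 0 :=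
  hasDerivAt_inv_act (X := fun t => (c t).X e.b) (z := fun t => (c t).z e) (hc.hasDerivAt_X e.b) (hc.diff_z e).hasDerivAt

theorem IsVariation.trace_gen (hc : IsVariation P c) (a : Fin 5) : (gen c a).trace = 0 :=
  trace_inv_mul_deriv (X := fun t => (c t).X a) (hc.hasDerivAt_X a)

theorem IsVariation.hasDerivAt_hat (hc : IsVariation P c) (e : Triangle) :
    HasDerivAt (fun t => hat ((c t).η e)) (deriv (fun t => hat ((c t).η e)) 0) 0 :=
  (differentiableAt_hat (hc.diff_η e) ((c 0).η_ne e)).hasDerivAt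

theorem two_mul_spin (B : BoundaryData) (a b : Fin 5) :
    2 * (B.spin a b : ℂ) = (B.twoSpin a b : ℂ) := by
  rw [BoundaryData.spin]
  push_cast
  ring

theorem IsVariation.hasDerivAt_eprlAction (hc : IsVariation P c) (B : BoundaryData) (γ : ℝ)
    (h : ∀ e, Aligned B (c 0) e) :
    HasDerivAt (fun t => eprlAction B γ (c 0) (c t))
      (∑ e : Triangle, (B.twoSpin e.a e.b : ℂ) * (Complex.I * (phaseForm γ (flow c e) : ℂ) +
        inner ℂ (J (deriv (fun t => hat ((c t).η e)) 0)) (J (hat ((c 0).η e))))) 0 := by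
  refine HasDerivAt.fun_sum fun e _ => ?_
  obtain ⟨⟨α, h1⟩, ⟨α', h2⟩⟩ := h e
  have hα : α ≠ 0 := by
    rintro rfl
    exact ne_zero_of_norm_one (B.norm_ξ_ab e) (by simpa using h1)
  rw [← two_mul_spin]
  exact hasDerivAt_eprlTerm (u := fun t => (c t).Zab e) (v := fun t => (c t).Zba e)
    (h := fun t => J (hat ((c t).η e))) (B.spin e.a e.b) γ (hc.hasDerivAt_Zab e) (hc.hasDerivAt_Zba e)
    (hasDerivAt_J (hc.hasDerivAt_hat e)) ((c 0).Zab_ne e) ((c 0).Zba_ne e) (norm_J_hat (c 0) e)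
    hα h1 h2

/-! ### The projector along a variation -/

theorem IsVariation.differentiableAt_rel (hc : IsVariation P c) (a b : Fin 5) (i j : Fin 2) :
    DifferentiableAt ℝ (fun t => (rel (c t).X a b : Matrix (Fin 2) (Fin 2) ℂ) i j) 0 := by
  have h := hc.diff_X
  simp only [rel, Matrix.SpecialLinearGroup.coe_mul, Matrix.SpecialLinearGroup.coe_inv,
    Matrix.adjugate_fin_two, Matrix.mul_apply, Fin.sum_univ_two]
  have ha00 := h a 0 0
  have ha01 := h a 0 1
  have ha10 := h a 1 0
  have ha11 := h a 1 1
  have hb0 := h b 0 j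
  have hb1 := h b 1 j
  fin_cases i <;>
  · simp
    fun_prop

theorem IsVariation.differentiableAt_boostVec (hc : IsVariation P c) (a b : Fin 5) (i : Fin 3) :
    DifferentiableAt ℝ (fun t => boostVec (c t).X a b i) 0 := by
  have h := hc.differentiableAt_rel a b
  have h' : ∀ i j, DifferentiableAt ℝ
      (fun t => star ((rel (c t).X a b : Matrix (Fin 2) (Fin 2) ℂ) i j)) 0 :=
    fun i j => (h i j).star
  have h2 : DifferentiableAt ℝ (fun t => Matrix.trace (pauli i *
      (rel (c t).X a b : Matrix (Fin 2) (Fin 2) ℂ) *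
      (rel (c t).X a b : Matrix (Fin 2) (Fin 2) ℂ)ᴴ)) 0 := by
    simp only [Matrix.trace, Matrix.diag, Matrix.mul_apply, Matrix.conjTranspose_apply]
    exact DifferentiableAt.fun_sum fun x _ => DifferentiableAt.fun_sum fun y _ =>
      (DifferentiableAt.fun_sum fun z _ => (differentiableAt_const _).mul (h z y)).mul (h' x y)
  exact (Complex.reCLM.differentiableAt.comp 0 h2).div_const 2

theorem IsVariation.continuousAt_tripleProduct (hc : IsVariation P c) (a : Fin 5)
    (s : Fin 3 → Fin 5) : ContinuousAt (fun t => tripleProduct (c t).X a s) 0 := by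
  have h := fun b i => (hc.differentiableAt_boostVec a b i).continuousAt
  simp only [tripleProduct]
  exact ContinuousAt.comp (g := Matrix.det) (continuous_id.matrix_det).continuousAt
    (continuousAt_pi.2 fun r => continuousAt_pi.2 fun i => h _ i)

theorem eventually_sign_eq {f : ℝ → ℝ} (hf : ContinuousAt f 0) (h0 : f 0 ≠ 0) :
    ∀ᶠ t in nhds 0, Real.sign (f t) = Real.sign (f 0) := by
  rcases lt_or_gt_of_ne h0 with h | h
  · filter_upwards [hf.eventually (gt_mem_nhds h)] with t ht
    rw [Real.sign_of_neg ht, Real.sign_of_neg h]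
  · filter_upwards [hf.eventually (lt_mem_nhds h)] with t ht
    rw [Real.sign_of_pos ht, Real.sign_of_pos h]

/-- A non-zero sign is locally constant, so `β` behaves as a constant in derivatives. -/
theorem IsVariation.eventually_β_eq (hc : IsVariation P c) {a b : Fin 5}
    (h0 : β (c 0).X a b ≠ 0) : ∀ᶠ t in nhds 0, β (c t).X a b = β (c 0).X a b := by
  refine eventually_sign_eq ((hc.continuousAt_tripleProduct a _).mul
    (hc.continuousAt_tripleProduct b _)) fun h => h0 ?_
  rw [β, h, Real.sign_zero]

theorem IsVariation.differentiableAt_properVec (hc : IsVariation P c) {a b : Fin 5}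
    (h0 : β (c 0).X a b ≠ 0) (i : Fin 3) :
    DifferentiableAt ℝ (fun t => properVec (c t).X a b i) 0 := by
  refine ((hc.differentiableAt_boostVec a b i).const_mul
    (β (c 0).X a b)).congr_of_eventuallyEq ?_
  filter_upwards [hc.eventually_β_eq h0] with t ht
  rw [properVec, ht]

theorem β_ne_zero_of_properVec {X : Fin 5 → SL2C} {a b : Fin 5} (h : properVec X a b ≠ 0) :
    β X a b ≠ 0 := by
  intro h0
  apply h
  funext i
  simp [properVec, h0]

theorem IsVariation.hasDerivAt_projTerm (hc : IsVariation P c) (B : BoundaryData) (e : Triangle)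
    (h : ‖projArg B (c 0) e‖ = 1) :
    HasDerivAt (fun t => branchLog (projArg B (c 0) e) (projArg B (c t) e))
      ((B.twoSpin e.a e.b : ℂ) *
        inner ℂ (deriv (fun t => hat ((c t).η e)) 0) (hat ((c 0).η e))) 0 := by
  obtain ⟨⟨hw0, hw⟩, l, hl⟩ := (norm_projArg_eq_one_iff B (c 0) e).1 h
  have hn := B.twoSpin_pos' e
  have h0 : projArg B (c 0) e ≠ 0 := by
    rw [← norm_ne_zero_iff, h]
    exact one_ne_zero
  have hproj : projArg B (c 0) e =
      inner ℂ (hat ((c 0).η e)) (B.ξ e.b e.a) ^ B.twoSpin e.a e.b := by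
    rw [projArg_eq, spectralProjector_apply_of_mem
      (coherent_mem_posSpace hn (len_pos hw0) hw), inner_coherent]
  have hd : HasDerivAt (fun t => projArg B (c t) e) _ 0 :=
    hasDerivAt_projected hn (fun i => hc.differentiableAt_properVec (β_ne_zero_of_properVec hw0) i)
      hw0 (hc.hasDerivAt_hat e) hw hl
  refine (hasDerivAt_branchLog hd h0).congr_deriv ?_
  -- As `|l| = 1`, the logarithmic derivative `n ⟨η', ξ⟩ / ⟨η̂, ξ⟩` equals `n ⟨η', η̂⟩`.
  have hl1 : star l * l = 1 := by
    have h1 := inner_self_of_norm_one (norm_hat ((c 0).η_ne e))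
    rw [hl, inner_smul_left, inner_smul_right, inner_self_of_norm_one (B.norm_ξ_ba e)] at h1
    simpa using h1
  have hl0 : star l ≠ 0 := left_ne_zero_of_mul_eq_one hl1
  have hin : inner ℂ (hat ((c 0).η e)) (B.ξ e.b e.a) = star l := by
    rw [hl, inner_smul_left, inner_self_of_norm_one (B.norm_ξ_ba e), mul_one]
    rfl
  rw [hproj, hin]
  conv_rhs => rw [hl, inner_smul_right]
  rw [div_eq_iff (pow_ne_zero _ hl0)]
  obtain ⟨m, hm⟩ := Nat.exists_eq_succ_of_ne_zero hn.ne'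
  rw [hm, Nat.succ_sub_one, pow_succ]
  linear_combination (-((m.succ : ℂ) * inner ℂ (deriv (fun t => hat ((c t).η e)) 0)
    (B.ξ e.b e.a) * star l ^ m)) * hl1

theorem IsVariation.hasDerivAt_properAction (hc : IsVariation P c) (B : BoundaryData) (γ : ℝ)
    (h : ∀ e, Aligned B (c 0) e) (h' : ∀ e, ‖projArg B (c 0) e‖ = 1) :
    HasDerivAt (fun t => properAction B γ (c 0) (c t))
      (Complex.I * (phaseForm γ (∑ e : Triangle, (B.twoSpin e.a e.b : ℂ) * flow c e) : ℂ)) 0 := by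
  have h1 : HasDerivAt (fun t => projAction B (c 0) (c t)) _ 0 :=
    HasDerivAt.fun_sum fun e _ => hc.hasDerivAt_projTerm B e (h' e)
  refine ((hc.hasDerivAt_eprlAction B γ h).add h1).congr_deriv ?_
  rw [← Finset.sum_add_distrib, phaseForm_sum, Complex.ofReal_sum, Finset.mul_sum]
  refine Finset.sum_congr rfl fun e _ => ?_
  -- The two `η`-terms add up to the derivative of `⟨η̂, η̂⟩ = 1`, hence cancel.
  have h2 := (hc.hasDerivAt_hat e).inner ℂ (hc.hasDerivAt_hat e)
  have h3 : (fun t => inner ℂ (hat ((c t).η e)) (hat ((c t).η e)) : ℝ → ℂ) = fun _ => 1 :=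
    funext fun t => inner_self_of_norm_one (norm_hat ((c t).η_ne e))
  rw [h3] at h2
  have h4 := h2.unique (hasDerivAt_const _ _)
  have h5 := phaseForm_ofReal_mul γ (B.twoSpin e.a e.b) (flow c e)
  rw [Complex.ofReal_natCast] at h5
  rw [inner_J_J, h5]
  push_cast
  linear_combination (B.twoSpin e.a e.b : ℂ) * h4

theorem IsVariation.withBoundary (hc : IsVariation P c) (B : BoundaryData) :
    IsVariation ((c 0).withBoundary B).toPoint fun t => (c t).withBoundary B where
  start := rfl
  diff_X := hc.diff_X
  diff_z := hc.diff_z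
  diff_η _ := differentiableAt_const _

theorem IsVariation.hasDerivAt_eprlAction_withBoundary (hc : IsVariation P c) (B : BoundaryData)
    (γ : ℝ) (h : ∀ e, Aligned B ((c 0).withBoundary B) e) :
    HasDerivAt (fun t => eprlAction B γ ((c 0).withBoundary B) ((c t).withBoundary B))
      (Complex.I * (phaseForm γ (∑ e : Triangle, (B.twoSpin e.a e.b : ℂ) * flow c e) : ℂ)) 0 := by
  refine ((hc.withBoundary B).hasDerivAt_eprlAction B γ h).congr_deriv ?_
  rw [phaseForm_sum, Complex.ofReal_sum, Finset.mul_sum]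
  refine Finset.sum_congr rfl fun e _ => ?_
  have h5 := phaseForm_ofReal_mul γ (B.twoSpin e.a e.b) (flow c e)
  rw [Complex.ofReal_natCast] at h5
  have h6 : deriv (fun t => hat (((c t).withBoundary B).η e)) 0 = 0 :=
    deriv_const 0 (hat (B.ξ e.b e.a))
  have h7 : flow (fun t => (c t).withBoundary B) e = flow c e := rfl
  rw [inner_J_J, h6, h5, h7, inner_zero_right, add_zero]
  push_cast
  ring

end Variation

/-! ### Stationarity as closure and orientation -/

theorem inner_act_of_parallel {u v : Spinor} {α : ℂ} (Y : Matrix (Fin 2) (Fin 2) ℂ) (hu : ‖u‖ = 1)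
    (h : u = α • v) : inner ℂ u (act Y u) = inner ℂ v (act Y v) / inner ℂ v v := by
  have h1 := inner_self_of_norm_one hu
  rw [h, inner_smul_left, inner_smul_right] at h1
  have hv : (inner ℂ v v : ℂ) ≠ 0 := by
    intro h0
    rw [h0, mul_zero, mul_zero] at h1
    exact zero_ne_one h1
  rw [eq_div_iff hv, h, act_smul, inner_smul_left, inner_smul_right]
  linear_combination inner ℂ v (act Y v) * h1

/-- The orthogonal spinors `u` and `J u` have equal norm, so the two expectation values add up to a
multiple of the trace. -/
theorem inner_J_act_J {Y : Matrix (Fin 2) (Fin 2) ℂ} (hY : Y.trace = 0) (u : Spinor) :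
    inner ℂ (J u) (act Y (J u)) = -inner ℂ u (act Y u) := by
  rw [Matrix.trace_fin_two] at hY
  simp only [inner_spinor, J_apply_zero, J_apply_one, act_apply_zero, act_apply_one, star_neg,
    star_star]
  linear_combination (u 1 * star (u 1) + u 0 * star (u 0)) * hY

/-- The vector whose vanishing is the orientation equation for the inverse adjoints. -/
def defect (c : Configuration) (e : Triangle) : Spinor :=
  (inner ℂ (c.Zba e) (c.Zba e) : ℂ)⁻¹ •
      act ((c.X e.b : Matrix (Fin 2) (Fin 2) ℂ)ᴴ)⁻¹ (c.Zba e) -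
    (inner ℂ (c.Zab e) (c.Zab e) : ℂ)⁻¹ •
      act ((c.X e.a : Matrix (Fin 2) (Fin 2) ℂ)ᴴ)⁻¹ (c.Zab e)

theorem inner_defect (c : Configuration) (e : Triangle) (v : Spinor) :
    inner ℂ (defect c e) v =
      inner ℂ (c.Zba e) (act ((c.X e.b)⁻¹ : SL2C) v) / inner ℂ (c.Zba e) (c.Zba e) -
      inner ℂ (c.Zab e) (act ((c.X e.a)⁻¹ : SL2C) v) / inner ℂ (c.Zab e) (c.Zab e) := by
  rw [defect, inner_sub_left, inner_smul_left, inner_smul_left, conjTranspose_inv_SL,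
    conjTranspose_inv_SL, inner_act_left, inner_act_left, Matrix.conjTranspose_conjTranspose,
    Matrix.conjTranspose_conjTranspose, map_inv₀, map_inv₀, inner_conj_symm, inner_conj_symm]
  ring

/-- Rescaling `z` is not a motion in projective space. Thus only the direction `J z` remains to be
tested. -/
theorem inner_defect_z (c : Configuration) (e : Triangle) : inner ℂ (defect c e) (c.z e) = 0 := by
  rw [inner_defect]
  change inner ℂ (c.Zba e) (c.Zba e) / inner ℂ (c.Zba e) (c.Zba e) -
      inner ℂ (c.Zab e) (c.Zab e) / inner ℂ (c.Zab e) (c.Zab e) = (0 : ℂ)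
  rw [div_self (inner_self_ne_zero.2 (c.Zba_ne e)), div_self (inner_self_ne_zero.2 (c.Zab_ne e)),
    sub_self]

theorem defect_of_smul {c d : Configuration} {e : Triangle} {a : ℂ} (ha : a ≠ 0) (hX : c.X = d.X)
    (hz : c.z e = a • d.z e) (h : defect d e = 0) : defect c e = 0 := by
  have h1 : ∀ N : ℂ, (star a * (a * N))⁻¹ * a = (star a)⁻¹ * N⁻¹ := by
    intro N
    have : star a ≠ 0 := star_ne_zero.2 ha
    rw [mul_inv, mul_inv]
    field_simp
  have h2 : defect c e = (star a)⁻¹ • defect d e := by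
    rw [defect, Zab_of_smul hX hz, Zba_of_smul hX hz, hX, defect, smul_sub]
    simp only [inner_smul_left, inner_smul_right, act_smul, smul_smul, starRingEnd_apply]
    simp only [mul_left_comm a, h1]
  rw [h2, h, smul_zero]

/-- The relative minus sign between the ends `b` and `a` is undone by `J`, so `ξ_ab` and `ξ_ba`
enter symmetrically and the sum can be regrouped by tetrahedron. -/
theorem flow_eq {P : Point} {c : ℝ → Configuration} (hc : IsVariation P c) {B : BoundaryData}
    {e : Triangle} (h : Aligned B (c 0) e) {l : ℂ} (hl : hat ((c 0).η e) = l • B.ξ e.b e.a) :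
    flow c e = (inner ℂ (B.ξ e.a e.b) (act (gen c e.a) (B.ξ e.a e.b)) +
      inner ℂ (B.ξ e.b e.a) (act (gen c e.b) (B.ξ e.b e.a))) +
      inner ℂ (defect (c 0) e) (velz c e) := by
  obtain ⟨⟨α, h1⟩, ⟨α', h2⟩⟩ := h
  have h3 := inner_act_of_parallel (gen c e.a) (B.norm_ξ_ab e) h1
  have h4 := inner_act_of_parallel (gen c e.b) (norm_J_hat (c 0) e) h2
  have h5 := inner_act_of_parallel (gen c e.b) (norm_hat ((c 0).η_ne e)) hl
  rw [inner_self_of_norm_one (B.norm_ξ_ba e), div_one] at h5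
  rw [inner_J_act_J (hc.trace_gen e.b), h5] at h4
  rw [flow, velZab, velZba, inner_sub_right, inner_sub_right, inner_defect, h3, sub_div, sub_div,
    ← h4]
  ring

theorem sum_triangle (h : Fin 5 → Fin 5 → ℂ) :
    ∑ e : Triangle, (h e.a e.b + h e.b e.a) = ∑ a, ∑ b ∈ Finset.univ.erase a, h a b := by
  have h1 : ∑ e : Triangle, (h e.a e.b + h e.b e.a) =
      ∑ p ∈ Finset.univ.filter (fun p : Fin 5 × Fin 5 => p.1 < p.2),
        (h p.1 p.2 + h p.2 p.1) :=
    (Finset.sum_subtype _ (by simp) (fun p : Fin 5 × Fin 5 => h p.1 p.2 + h p.2 p.1)).symm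
  have h2 : ∀ a : Fin 5, ∑ b ∈ Finset.univ.erase a, h a b = ∑ b, if b ≠ a then h a b else 0 := by
    intro a
    rw [← Finset.sum_filter]
    congr 1
    ext b
    simp
  rw [h1, Finset.sum_filter, Fintype.sum_prod_type]
  simp only [h2, Fin.sum_univ_five]
  simp
  ring

/-- The quadratic form whose values on the Pauli matrices are twice the closure sums. -/
def closureForm (B : BoundaryData) (a : Fin 5) (Y : Matrix (Fin 2) (Fin 2) ℂ) : ℂ :=
  ∑ b ∈ Finset.univ.erase a, (B.twoSpin a b : ℂ) * inner ℂ (B.ξ a b) (act Y (B.ξ a b))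

theorem closureForm_add (B : BoundaryData) (a : Fin 5) (Y W : Matrix (Fin 2) (Fin 2) ℂ) :
    closureForm B a (Y + W) = closureForm B a Y + closureForm B a W := by
  simp only [closureForm, add_act, inner_add_right, mul_add, Finset.sum_add_distrib]

theorem closureForm_smul (B : BoundaryData) (a : Fin 5) (s : ℂ) (Y : Matrix (Fin 2) (Fin 2) ℂ) :
    closureForm B a (s • Y) = s * closureForm B a Y := by
  simp only [closureForm, smul_act, inner_smul_right, Finset.mul_sum]
  exact Finset.sum_congr rfl fun b _ => by ring

theorem pauliVec_single (i : Fin 3) : pauliVec (Pi.single i 1) = pauli i := by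
  ext r s
  rw [pauliVec_eq]
  fin_cases i <;> fin_cases r <;> fin_cases s <;> simp [pauli]

theorem closureForm_pauli (B : BoundaryData) (a : Fin 5) (i : Fin 3) :
    closureForm B a (pauli i) =
      ((2 * ∑ b ∈ Finset.univ.erase a, B.spin a b * nvec (B.ξ a b) i : ℝ) : ℂ) := by
  rw [closureForm, Finset.mul_sum, Complex.ofReal_sum]
  refine Finset.sum_congr rfl fun b hb => ?_
  have h := inner_pauliVec (Pi.single i 1) (B.ξ_unit a b (Finset.ne_of_mem_erase hb).symm)
  rw [pauliVec_single] at h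
  rw [h, ← two_mul_spin]
  simp [Pi.single_apply]
  ring

theorem closure_iff (B : BoundaryData) : Closure B ↔ ∀ a i, closureForm B a (pauli i) = 0 := by
  refine forall_congr' fun a => forall_congr' fun i => ?_
  rw [closureForm_pauli, Complex.ofReal_eq_zero, mul_eq_zero]
  simp

/-- The Pauli matrices span the traceless matrices over `ℂ`. -/
theorem closureForm_eq_zero {B : BoundaryData} (h : Closure B) (a : Fin 5)
    {Y : Matrix (Fin 2) (Fin 2) ℂ} (hY : Y.trace = 0) : closureForm B a Y = 0 := by
  rw [closure_iff] at h
  have h1 : Y = ((Y 0 1 + Y 1 0) / 2) • pauli 0 +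
      (Complex.I * (Y 0 1 - Y 1 0) / 2) • pauli 1 + (Y 0 0) • pauli 2 := by
    rw [Matrix.trace_fin_two] at hY
    have hI := Complex.I_mul_I
    ext r s
    fin_cases r <;> fin_cases s <;> simp [pauli]
    · linear_combination (Y 0 1 - Y 1 0) / 2 * hI
    · linear_combination -(Y 0 1 - Y 1 0) / 2 * hI
    · linear_combination hY
  rw [h1, closureForm_add, closureForm_add, closureForm_smul, closureForm_smul, closureForm_smul,
    h, h, h]
  simp

theorem sum_flow_eq {P : Point} {c : ℝ → Configuration} (hc : IsVariation P c) {B : BoundaryData}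
    (h : ∀ e, Aligned B (c 0) e) (hl : ∀ e, ∃ l : ℂ, hat ((c 0).η e) = l • B.ξ e.b e.a) :
    ∑ e : Triangle, (B.twoSpin e.a e.b : ℂ) * flow c e =
      ∑ a, closureForm B a (gen c a) +
        ∑ e : Triangle, (B.twoSpin e.a e.b : ℂ) * inner ℂ (defect (c 0) e) (velz c e) := by
  have h1 := sum_triangle fun a b =>
    (B.twoSpin a b : ℂ) * inner ℂ (B.ξ a b) (act (gen c a) (B.ξ a b))
  have h2 : ∑ a, closureForm B a (gen c a) = _ := h1.symm
  rw [h2, ← Finset.sum_add_distrib]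
  refine Finset.sum_congr rfl fun e _ => ?_
  obtain ⟨l, hle⟩ := hl e
  rw [flow_eq hc (h e) hle, B.twoSpin_comm e.b e.a]
  ring

/-! ### Test variations -/

/-- The unipotent one-parameter group generated by a nilpotent matrix. -/
def unipotent (N : Matrix (Fin 2) (Fin 2) ℂ) (hT : N.trace = 0) (hD : N.det = 0) (t : ℝ) : SL2C :=
  ⟨1 + (t : ℂ) • N, by
    rw [Matrix.trace_fin_two] at hT
    rw [Matrix.det_fin_two] at hD ⊢
    simp
    linear_combination (t : ℂ) * hT + (t : ℂ) ^ 2 * hD⟩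

/-- The curve which translates `X_a` along a unipotent one-parameter group. -/
def translateX (C : Configuration) (a : Fin 5) (N : Matrix (Fin 2) (Fin 2) ℂ) (hT : N.trace = 0)
    (hD : N.det = 0) (t : ℝ) : Configuration :=
  { C with X := Function.update C.X a (C.X a * unipotent N hT hD t) }

theorem add_smul_J_ne_zero {u : Spinor} (hu : u ≠ 0) (s : ℂ) : u + s • J u ≠ 0 := by
  intro h
  have h1 : inner ℂ u (u + s • J u) = inner ℂ u u := by
    rw [inner_add_right, inner_smul_right, inner_self_J, mul_zero, add_zero]
  rw [h, inner_zero_right] at h1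
  exact hu (inner_self_eq_zero.1 h1.symm)

/-- The curve which moves `z_ab` in the direction of `J z_ab`. -/
def translateZ (C : Configuration) (e : Triangle) (s : ℂ) (t : ℝ) : Configuration :=
  { C with
    z := fun f => C.z f + (if f = e then (t : ℂ) * s else 0) • J (C.z f)
    z_ne := fun f => add_smul_J_ne_zero (C.z_ne f) _ }

theorem configuration_ext {C D : Configuration} (hX : C.X = D.X) (hz : C.z = D.z)
    (hη : C.η = D.η) : C = D := by
  cases C
  cases D
  simp_all

theorem translateX_zero (C : Configuration) (a : Fin 5) (N : Matrix (Fin 2) (Fin 2) ℂ)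
    (hT : N.trace = 0) (hD : N.det = 0) : translateX C a N hT hD 0 = C := by
  refine configuration_ext ?_ rfl rfl
  have h : unipotent N hT hD 0 = 1 := by
    apply Subtype.ext
    simp [unipotent]
  simp [translateX, h]

theorem translateZ_zero (C : Configuration) (e : Triangle) (s : ℂ) : translateZ C e s 0 = C := by
  refine configuration_ext rfl ?_ rfl
  funext f
  simp [translateZ]

theorem hasDerivAt_translateX (C : Configuration) (a : Fin 5) (N : Matrix (Fin 2) (Fin 2) ℂ)
    (hT : N.trace = 0) (hD : N.det = 0) (a' : Fin 5) (i j : Fin 2) :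
    HasDerivAt (fun t => ((translateX C a N hT hD t).X a' : Matrix (Fin 2) (Fin 2) ℂ) i j)
      ((if a' = a then (C.X a : Matrix (Fin 2) (Fin 2) ℂ) * N else 0) i j) 0 := by
  by_cases h : a' = a
  · subst h
    have h1 : ∀ t, ((translateX C a' N hT hD t).X a' : Matrix (Fin 2) (Fin 2) ℂ) i j =
        (C.X a' : Matrix (Fin 2) (Fin 2) ℂ) i j +
          (t : ℂ) * ((C.X a' : Matrix (Fin 2) (Fin 2) ℂ) * N) i j := by
      intro t
      have h2 : (translateX C a' N hT hD t).X a' = C.X a' * unipotent N hT hD t :=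
        Function.update_self _ _ _
      rw [h2, Matrix.SpecialLinearGroup.coe_mul]
      change ((C.X a' : Matrix (Fin 2) (Fin 2) ℂ) * (1 + (t : ℂ) • N)) i j = _
      rw [mul_add, mul_one, Matrix.mul_smul]
      rfl
    simp only [h1, if_true]
    have h2 := ((Complex.ofRealCLM.hasDerivAt (x := 0)).mul_const
      (((C.X a' : Matrix (Fin 2) (Fin 2) ℂ) * N) i j)).const_add
        ((C.X a' : Matrix (Fin 2) (Fin 2) ℂ) i j)
    simpa using h2
  · simp only [translateX, Function.update_of_ne h, if_neg h, Matrix.zero_apply]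
    exact hasDerivAt_const _ _

theorem hasDerivAt_translateZ (C : Configuration) (e : Triangle) (s : ℂ) (f : Triangle) :
    HasDerivAt (fun t => (translateZ C e s t).z f) (if f = e then s • J (C.z f) else 0) 0 := by
  by_cases h : f = e
  · simp only [translateZ, if_pos h]
    have h2 := (((Complex.ofRealCLM.hasDerivAt (x := 0)).mul_const s).smul_const
      (J (C.z f))).const_add (C.z f)
    simpa using h2
  · simp only [translateZ, if_neg h, zero_smul]
    exact hasDerivAt_const _ _

theorem isVariation_translateX (P : Point) (a : Fin 5) (N : Matrix (Fin 2) (Fin 2) ℂ)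
    (hT : N.trace = 0) (hD : N.det = 0) : IsVariation P (translateX P.rep a N hT hD) where
  start := by rw [translateX_zero, Point.rep_toPoint]
  diff_X a' i j := (hasDerivAt_translateX P.rep a N hT hD a' i j).differentiableAt
  diff_z _ := differentiableAt_const _
  diff_η _ := differentiableAt_const _

theorem isVariation_translateZ (P : Point) (e : Triangle) (s : ℂ) :
    IsVariation P (translateZ P.rep e s) where
  start := by rw [translateZ_zero, Point.rep_toPoint]
  diff_X a i j := differentiableAt_const ((P.X a : Matrix (Fin 2) (Fin 2) ℂ) i j)
  diff_z f := (hasDerivAt_translateZ P.rep e s f).differentiableAt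
  diff_η _ := differentiableAt_const _

theorem gen_translateX (C : Configuration) (a : Fin 5) (N : Matrix (Fin 2) (Fin 2) ℂ)
    (hT : N.trace = 0) (hD : N.det = 0) (a' : Fin 5) :
    gen (translateX C a N hT hD) a' = if a' = a then N else 0 := by
  have h : velX (translateX C a N hT hD) a' =
      if a' = a then (C.X a : Matrix (Fin 2) (Fin 2) ℂ) * N else 0 := by
    ext i j
    exact (hasDerivAt_translateX C a N hT hD a' i j).deriv
  rw [gen, h, translateX_zero]
  by_cases h' : a' = a
  · subst h'
    rw [if_pos rfl, if_pos rfl, ← mul_assoc, ← Matrix.SpecialLinearGroup.coe_mul, inv_mul_cancel,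
      Matrix.SpecialLinearGroup.coe_one, one_mul]
  · rw [if_neg h', if_neg h', mul_zero]

theorem gen_translateZ (C : Configuration) (e : Triangle) (s : ℂ) (a : Fin 5) :
    gen (translateZ C e s) a = 0 := by
  have h : velX (translateZ C e s) a = 0 := by
    ext i j
    exact deriv_const 0 ((C.X a : Matrix (Fin 2) (Fin 2) ℂ) i j)
  rw [gen, h, mul_zero]

theorem closureForm_zero (B : BoundaryData) (a : Fin 5) : closureForm B a 0 = 0 := by
  simpa using closureForm_smul B a 0 0

theorem aligned_of_toPoint {B : BoundaryData} {P : Point} {c : Configuration} (hc : c.toPoint = P)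
    {e : Triangle} (h : Aligned B P.rep e) : Aligned B c e := by
  obtain ⟨hX, hz, hη⟩ := rep_of_toPoint hc
  obtain ⟨a, ha, hz⟩ := hz e
  obtain ⟨b, -, hη⟩ := hη e
  exact aligned_of_smul ha hX hz hη h

theorem parallel_of_toPoint {B : BoundaryData} {P : Point} {c : Configuration} (hc : c.toPoint = P)
    {e : Triangle} (h : ∃ l : ℂ, hat (P.rep.η e) = l • B.ξ e.b e.a) :
    ∃ l : ℂ, hat (c.η e) = l • B.ξ e.b e.a := by
  obtain ⟨b, -, hη⟩ := (rep_of_toPoint hc).2.2 e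
  obtain ⟨l, hl⟩ := h
  obtain ⟨m, -, hm⟩ := hat_parallel (c.η_ne e) hη
  refine ⟨m * ((‖P.rep.η e‖ : ℂ) * l), ?_⟩
  rw [hm, mul_smul, mul_smul, ← hl, ← eq_norm_smul_hat (P.rep.η_ne e)]

theorem defect_of_toPoint {P : Point} {c : Configuration} (hc : c.toPoint = P)
    {e : Triangle} (h : defect P.rep e = 0) : defect c e = 0 := by
  obtain ⟨hX, hz, -⟩ := rep_of_toPoint hc
  obtain ⟨a, ha, hz⟩ := hz e
  exact defect_of_smul ha hX hz h

/-- Stationarity of the phase along all variations is equivalent to closure together with the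
orientation equation for the inverse adjoints. -/
theorem stationary_iff (B : BoundaryData) (γ : ℝ) (P : Point) (h : ∀ e, Aligned B P.rep e)
    (hl : ∀ e, ∃ l : ℂ, hat (P.rep.η e) = l • B.ξ e.b e.a) :
    (∀ c, IsVariation P c →
      phaseForm γ (∑ e : Triangle, (B.twoSpin e.a e.b : ℂ) * flow c e) = 0) ↔
      Closure B ∧ ∀ e, defect P.rep e = 0 := by
  constructor
  · intro hs
    constructor
    · rw [closure_iff]
      intro a
      -- For nilpotent `N` the curve `1 + t N` has determinant exactly `1`, so no exponential is
      -- needed.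
      have hnil : ∀ N : Matrix (Fin 2) (Fin 2) ℂ, N.trace = 0 → N.det = 0 →
          phaseForm γ (closureForm B a N) = 0 := by
        intro N hT hD
        have hc := isVariation_translateX P a N hT hD
        have h1 := hs _ hc
        rw [sum_flow_eq hc (by rwa [translateX_zero]) (by rwa [translateX_zero])] at h1
        have h2 : ∀ e, velz (translateX P.rep a N hT hD) e = 0 := fun e =>
          deriv_const 0 (P.rep.z e)
        simp only [h2, inner_zero_right, mul_zero, Finset.sum_const_zero, add_zero,
          gen_translateX] at h1
        rw [Finset.sum_eq_single a (fun b _ hb => by rw [if_neg hb, closureForm_zero])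
          (fun hb => absurd (Finset.mem_univ a) hb), if_pos rfl] at h1
        exact h1
      have hnil' : ∀ N : Matrix (Fin 2) (Fin 2) ℂ, N.trace = 0 → N.det = 0 →
          closureForm B a N = 0 := by
        intro N hT hD
        -- The second test direction is `i N`, which is again nilpotent.
        refine eq_zero_of_phaseForm (hnil N hT hD) ?_
        rw [← closureForm_smul]
        exact hnil _ (by rw [Matrix.trace_smul, hT, smul_zero])
          (by rw [Matrix.det_smul, hD, mul_zero])
      have hE := hnil' !![0, 1; 0, 0] (by simp [Matrix.trace_fin_two])
        (by simp [Matrix.det_fin_two])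
      have hF := hnil' !![0, 0; 1, 0] (by simp [Matrix.trace_fin_two])
        (by simp [Matrix.det_fin_two])
      -- A third nilpotent completes a basis of the traceless matrices: adding the first and
      -- subtracting the second leaves the diagonal Pauli matrix.
      have hG := hnil' !![1, -1; 1, -1] (by simp [Matrix.trace_fin_two])
        (by simp [Matrix.det_fin_two])
      have hcomb : ∀ x y z : ℂ, closureForm B a (x • !![0, 1; 0, 0] + y • !![0, 0; 1, 0] +
          z • !![1, -1; 1, -1]) = 0 := by
        intro x y z
        rw [closureForm_add, closureForm_add, closureForm_smul, closureForm_smul,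
          closureForm_smul, hE, hF, hG]
        simp
      intro i
      fin_cases i
      · convert hcomb 1 1 0 using 2
        ext r s
        fin_cases r <;> fin_cases s <;> simp [pauli]
      · convert hcomb (-Complex.I) Complex.I 0 using 2
        ext r s
        fin_cases r <;> fin_cases s <;> simp [pauli]
      · convert hcomb 1 (-1) 1 using 2
        ext r s
        fin_cases r <;> fin_cases s <;> simp [pauli]
    · intro e
      have hn : (B.twoSpin e.a e.b : ℝ) ≠ 0 := by exact_mod_cast (B.twoSpin_pos' e).ne'
      have hJ : ∀ s : ℂ, phaseForm γ (inner ℂ (defect P.rep e) (s • J (P.rep.z e))) = 0 := by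
        intro s
        have hc := isVariation_translateZ P e s
        have h1 := hs _ hc
        rw [sum_flow_eq hc (by rwa [translateZ_zero]) (by rwa [translateZ_zero])] at h1
        have h2 : ∀ f, velz (translateZ P.rep e s) f = if f = e then s • J (P.rep.z f) else 0 :=
          fun f => (hasDerivAt_translateZ P.rep e s f).deriv
        simp only [h2, gen_translateZ, closureForm_zero, Finset.sum_const_zero, zero_add,
          translateZ_zero] at h1
        rw [Finset.sum_eq_single e (fun b _ hb => by rw [if_neg hb, inner_zero_right, mul_zero])
          (fun hb => absurd (Finset.mem_univ e) hb), if_pos rfl, ← Complex.ofReal_natCast,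
          phaseForm_ofReal_mul] at h1
        exact (mul_eq_zero.1 h1).resolve_left hn
      have h1 := hJ 1
      have h2 := hJ Complex.I
      rw [one_smul] at h1
      rw [inner_smul_right] at h2
      exact eq_zero_of_inner (P.rep.z_ne e) (inner_defect_z P.rep e)
        (eq_zero_of_phaseForm h1 h2)
  · rintro ⟨hcl, hd⟩ c hc
    have hd' : ∀ e, defect (c 0) e = 0 := fun e => defect_of_toPoint hc.start (hd e)
    rw [sum_flow_eq hc (fun e => aligned_of_toPoint hc.start (h e))
      fun e => parallel_of_toPoint hc.start (hl e)]
    simp only [hd', inner_zero_left, mul_zero, Finset.sum_const_zero, add_zero]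
    rw [Finset.sum_eq_zero fun a _ => closureForm_eq_zero hcl a (hc.trace_gen a)]
    simp [phaseForm]

/-! ### The orientation equations -/

/-- By alignment both sides of the first orientation equation are multiples of `z`, so it only fixes
the phase, `e^{iθ} = e^{i(φ - φ')}`. With that phase the second equation is a rescaling of `defect =
0`. -/
theorem oriented_iff_defect {B : BoundaryData} {c : Configuration} (h : ∀ e, Aligned B c e) :
    Oriented B c ↔ ∀ e, defect c e = 0 := by
  refine forall_congr' fun e => ?_
  obtain ⟨φ, φ', h1, h2⟩ := (maxEquation_iff_aligned B c e).2 (h e)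
  have hXa : act (c.X e.a) (c.Zab e) = c.z e := act_act_inv _ _
  have hXb : act (c.X e.b) (c.Zba e) = c.z e := act_act_inv _ _
  have hra : (‖c.Zab e‖ : ℂ) ≠ 0 := by exact_mod_cast norm_ne_zero_iff.2 (c.Zab_ne e)
  have hrb : (‖c.Zba e‖ : ℂ) ≠ 0 := by exact_mod_cast norm_ne_zero_iff.2 (c.Zba_ne e)
  have hNa : (inner ℂ (c.Zab e) (c.Zab e) : ℂ) = (‖c.Zab e‖ : ℂ) ^ 2 :=
    inner_self_eq_norm_sq_to_K _
  have hNb : (inner ℂ (c.Zba e) (c.Zba e) : ℂ) = (‖c.Zba e‖ : ℂ) ^ 2 :=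
    inner_self_eq_norm_sq_to_K _
  rw [h1, h2]
  simp only [act_smul, hXa, hXb, defect, hNa, hNb, smul_smul, Complex.ofReal_div]
  generalize act ((c.X e.a : Matrix (Fin 2) (Fin 2) ℂ)ᴴ)⁻¹ (c.Zab e) = wa
  generalize act ((c.X e.b : Matrix (Fin 2) (Fin 2) ℂ)ᴴ)⁻¹ (c.Zba e) = wb
  generalize (‖c.Zab e‖ : ℂ) = ra at hra ⊢
  generalize (‖c.Zba e‖ : ℂ) = rb at hrb ⊢
  have hp := Complex.exp_ne_zero (Complex.I * φ)
  have hq := Complex.exp_ne_zero (Complex.I * φ')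
  constructor
  · rintro ⟨θ, h3, h4⟩
    have h5 := smul_left_injective ℂ (c.z_ne e) h3
    have h6 : Complex.exp (Complex.I * φ) =
        Complex.exp (Complex.I * θ) * Complex.exp (Complex.I * φ') := by
      field_simp at h5
      exact h5
    generalize Complex.exp (Complex.I * φ) = p at *
    have h7 : (rb ^ 2)⁻¹ • wb = (p * ra)⁻¹ •
        ((ra / rb * Complex.exp (Complex.I * θ) * (Complex.exp (Complex.I * φ') / rb)) • wb) := by
      rw [smul_smul]
      congr 1
      field_simp
      exact h6
    rw [h7, ← h4, smul_smul, ← sub_smul]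
    have h8 : (p * ra)⁻¹ * (p / ra) - (ra ^ 2)⁻¹ = 0 := by
      field_simp
      ring
    rw [h8, zero_smul]
  · intro h3
    refine ⟨φ - φ', ?_, ?_⟩
    · congr 1
      push_cast
      rw [mul_sub, Complex.exp_sub]
      field_simp
    · have h4 : wa = (ra ^ 2) • ((rb ^ 2)⁻¹ • wb) := by
        rw [sub_eq_zero.1 h3, smul_smul, mul_inv_cancel₀ (pow_ne_zero 2 hra), one_smul]
      rw [h4, smul_smul, smul_smul]
      congr 1
      push_cast
      rw [mul_sub, Complex.exp_sub]
      field_simp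

/-! ### Eigenvectors of the relative boosts and proper orientation -/

/-- The two orientation equations in terms of the relative group element `M = X_ab`. -/
structure Intertwines (M : SL2C) (u v : Spinor) (s : ℝ) (E : ℂ) : Prop where
  norm_phase : ‖E‖ = 1
  pos : 0 < s
  eq_act : u = ((s : ℂ) * E) • act (M : Matrix (Fin 2) (Fin 2) ℂ) v
  adjoint_act : act (M : Matrix (Fin 2) (Fin 2) ℂ)ᴴ u = ((s : ℂ)⁻¹ * E) • v

theorem exists_intertwines {B : BoundaryData} {c : Configuration} (h : Oriented B c)
    (e : Triangle) : ∃ s E, Intertwines (rel c.X e.a e.b) (B.ξ e.a e.b) (J (hat (c.η e))) s E := by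
  obtain ⟨θ, h1, h2⟩ := h e
  refine ⟨‖c.Zba e‖ / ‖c.Zab e‖, Complex.exp (Complex.I * θ), ?_, ?_, ?_, ?_⟩
  · rw [mul_comm, Complex.norm_exp_ofReal_mul_I]
  · exact div_pos (norm_pos_iff.2 (c.Zba_ne e)) (norm_pos_iff.2 (c.Zab_ne e))
  · rw [rel, Matrix.SpecialLinearGroup.coe_mul, act_mul, ← act_smul, ← h1, act_inv_act]
  · have h3 : ∀ (X : SL2C) (u : Spinor), act (X : Matrix (Fin 2) (Fin 2) ℂ)ᴴ
        (act ((X : Matrix (Fin 2) (Fin 2) ℂ)ᴴ)⁻¹ u) = u := by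
      intro X u
      rw [conjTranspose_inv_SL, ← act_mul, ← Matrix.conjTranspose_mul,
        ← Matrix.SpecialLinearGroup.coe_mul]
      simp
    rw [rel, Matrix.SpecialLinearGroup.coe_mul, Matrix.conjTranspose_mul, act_mul,
      ← conjTranspose_inv_SL, h2, act_smul, h3]
    rw [Complex.ofReal_div, Complex.ofReal_div, inv_div]

section Intertwines

variable {M : SL2C} {u v : Spinor} {s : ℝ} {E : ℂ}

theorem Intertwines.norm_act (h : Intertwines M u v s E) (hu : ‖u‖ = 1) :
    ‖act (M : Matrix (Fin 2) (Fin 2) ℂ) v‖ = s⁻¹ := by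
  rw [h.eq_act, norm_smul, norm_mul, h.norm_phase, mul_one, Complex.norm_real,
    Real.norm_of_nonneg h.pos.le] at hu
  exact eq_inv_of_mul_eq_one_right hu

theorem Intertwines.norm_adjoint_act (h : Intertwines M u v s E) (hv : ‖v‖ = 1) :
    ‖act (M : Matrix (Fin 2) (Fin 2) ℂ)ᴴ u‖ = s⁻¹ := by
  rw [h.adjoint_act, norm_smul, norm_mul, h.norm_phase, mul_one, norm_inv, Complex.norm_real,
    Real.norm_of_nonneg h.pos.le, hv, mul_one]

/-- The adjoint equation sends `v` to a multiple of `u` and the direct one returns it to `v`; the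
phases cancel and the factors `s` multiply. -/
theorem Intertwines.inv_act (h : Intertwines M u v s E) :
    act (((M⁻¹ : SL2C) : Matrix (Fin 2) (Fin 2) ℂ) * ((M⁻¹ : SL2C) : Matrix (Fin 2) (Fin 2) ℂ)ᴴ) v =
      ((s ^ 2 : ℝ) : ℂ) • v := by
  have hs : (s : ℂ) ≠ 0 := by exact_mod_cast h.pos.ne'
  have hE : E ≠ 0 := by
    rw [← norm_ne_zero_iff, h.norm_phase]
    exact one_ne_zero
  have h1 : ((s : ℂ)⁻¹ * E) • act ((M⁻¹ : SL2C) : Matrix (Fin 2) (Fin 2) ℂ)ᴴ v = u := by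
    rw [← act_smul, ← h.adjoint_act, ← act_mul, ← Matrix.conjTranspose_mul,
      ← Matrix.SpecialLinearGroup.coe_mul]
    simp
  have h2 : act ((M⁻¹ : SL2C) : Matrix (Fin 2) (Fin 2) ℂ) u = ((s : ℂ) * E) • v := by
    rw [h.eq_act, act_smul, act_inv_act]
  rw [← h1, act_smul] at h2
  rw [act_mul]
  have h3 : act ((M⁻¹ : SL2C) : Matrix (Fin 2) (Fin 2) ℂ)
      (act ((M⁻¹ : SL2C) : Matrix (Fin 2) (Fin 2) ℂ)ᴴ v) =
      ((s : ℂ)⁻¹ * E)⁻¹ • (((s : ℂ) * E) • v) := by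
    rw [← h2, smul_smul, inv_mul_cancel₀ (mul_ne_zero (inv_ne_zero hs) hE), one_smul]
  rw [h3, smul_smul]
  congr 1
  push_cast
  field_simp

end Intertwines

/-- The squared Frobenius norm. -/
def frobSq (M : Matrix (Fin 2) (Fin 2) ℂ) : ℝ := ∑ i, ∑ j, ‖M i j‖ ^ 2

theorem frobSq_inv (M : SL2C) :
    frobSq ((M⁻¹ : SL2C) : Matrix (Fin 2) (Fin 2) ℂ) = frobSq (M : Matrix (Fin 2) (Fin 2) ℂ) := by
  simp only [frobSq, Matrix.SpecialLinearGroup.coe_inv, Matrix.adjugate_fin_two, Fin.sum_univ_two]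
  simp
  ring

theorem rel_inv (X : Fin 5 → SL2C) (a b : Fin 5) : rel X b a = (rel X a b)⁻¹ := by
  simp [rel]

theorem rel_mul_conjTranspose (X : Fin 5 → SL2C) (a b : Fin 5) :
    (rel X a b : Matrix (Fin 2) (Fin 2) ℂ) * (rel X a b : Matrix (Fin 2) (Fin 2) ℂ)ᴴ =
      ((frobSq (rel X a b) / 2 : ℝ) : ℂ) • (1 : Matrix (Fin 2) (Fin 2) ℂ) +
        pauliVec (boostVec X a b) :=
  mul_conjTranspose_eq _

/-- The expectation value of `X_ab X_ab†` in `u` is `‖X_ab† u‖²`; expanding it in Pauli matrices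
gives the formula. -/
theorem sum_nvec_traceVec (X : Fin 5 → SL2C) (a b : Fin 5) {u : Spinor} (hu : ‖u‖ = 1) :
    ∑ i, nvec u i * traceVec X a b i =
      2 * ‖act (rel X a b : Matrix (Fin 2) (Fin 2) ℂ)ᴴ u‖ ^ 2 - frobSq (rel X a b) := by
  have h1 : inner ℂ u (act ((rel X a b : Matrix (Fin 2) (Fin 2) ℂ) *
      (rel X a b : Matrix (Fin 2) (Fin 2) ℂ)ᴴ) u) =
      ((‖act (rel X a b : Matrix (Fin 2) (Fin 2) ℂ)ᴴ u‖ ^ 2 : ℝ) : ℂ) := by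
    rw [act_mul, inner_act_right, inner_self_eq_norm_sq_to_K]
    push_cast
    rfl
  rw [rel_mul_conjTranspose, add_act, smul_act, act_one, inner_add_right, inner_smul_right,
    inner_self_of_norm_one hu, inner_pauliVec _ hu, mul_one] at h1
  have h2 : frobSq (rel X a b) / 2 + ∑ i, nvec u i * boostVec X a b i =
      ‖act (rel X a b : Matrix (Fin 2) (Fin 2) ℂ)ᴴ u‖ ^ 2 := by exact_mod_cast h1
  rw [← h2]
  simp only [boostVec, Fin.sum_univ_three]
  ring

theorem norm_of_parallel {u v : Spinor} {l : ℂ} (hu : ‖u‖ = 1) (hv : ‖v‖ = 1) (h : u = l • v) :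
    ‖l‖ = 1 := by
  rw [h, norm_smul, hv, mul_one] at hu
  exact hu

/-- Both sides equal `2 s⁻²` minus the same Frobenius term, since inversion preserves `frobSq`. As
`β` is symmetric too, the inequality need only be known for one order of the labels. -/
theorem Intertwines.sum_nvec_eq {B : BoundaryData} {c : Configuration} {e : Triangle} {s : ℝ}
    {E l : ℂ} (h : Intertwines (rel c.X e.a e.b) (B.ξ e.a e.b) (J (hat (c.η e))) s E)
    (hl : hat (c.η e) = l • B.ξ e.b e.a) :
    ∑ i, nvec (B.ξ e.a e.b) i * traceVec c.X e.a e.b i =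
      ∑ i, nvec (B.ξ e.b e.a) i * traceVec c.X e.b e.a i := by
  have hl1 := norm_of_parallel (norm_hat (c.η_ne e)) (B.norm_ξ_ba e) hl
  rw [sum_nvec_traceVec _ _ _ (B.norm_ξ_ab e), sum_nvec_traceVec _ _ _ (B.norm_ξ_ba e),
    rel_inv c.X e.a e.b, frobSq_inv, h.norm_adjoint_act (norm_J_hat c e)]
  have h1 := h.norm_act (B.norm_ξ_ab e)
  rw [hl, J_smul, act_smul, norm_smul, norm_star, hl1, one_mul, ← norm_J, J_act_SL, J_J] at h1
  have h2 : ∀ (A : Matrix (Fin 2) (Fin 2) ℂ) (u : Spinor), act A (-u) = -act A u := by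
    intro A u
    rw [← neg_one_smul ℂ u, act_smul, neg_one_smul]
  rw [h2, norm_neg] at h1
  rw [h1]

theorem nvec_properVec (X : Fin 5 → SL2C) (a b : Fin 5) (u : Spinor) :
    ∑ i, nvec u i * properVec X a b i = (β X a b * ∑ i, nvec u i * traceVec X a b i) / 2 := by
  simp only [properVec, boostVec, Fin.sum_univ_three]
  ring

theorem Intertwines.highestWeight {B : BoundaryData} {c : Configuration} {e : Triangle} {s : ℝ}
    {E l : ℂ} (h : Intertwines (rel c.X e.a e.b) (B.ξ e.a e.b) (J (hat (c.η e))) s E)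
    (hl : hat (c.η e) = l • B.ξ e.b e.a)
    (hp : 0 < β c.X e.b e.a * ∑ i, nvec (B.ξ e.b e.a) i * traceVec c.X e.b e.a i) :
    HighestWeight B c.X e := by
  have hl1 := norm_of_parallel (norm_hat (c.η_ne e)) (B.norm_ξ_ba e) hl
  have hl0 : star l ≠ 0 := by
    rw [← norm_ne_zero_iff, norm_star, hl1]
    exact one_ne_zero
  have h1 := h.inv_act
  rw [← rel_inv, rel_mul_conjTranspose, hl, J_smul, act_smul, smul_comm _ (star l)] at h1
  have h2 := smul_right_injective Spinor hl0 h1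
  simp only [add_act, smul_act, act_one] at h2
  set μ : ℝ := s ^ 2 - frobSq (rel c.X e.b e.a) / 2
  have h3 : act (pauliVec (boostVec c.X e.b e.a)) (J (B.ξ e.b e.a)) =
      (μ : ℂ) • J (B.ξ e.b e.a) := by
    rw [eq_sub_of_add_eq' h2, ← sub_smul, ← Complex.ofReal_sub]
  have h4 := congrArg J h3
  -- Passing from `J ξ_ba` to `ξ_ba` reverses the sign of the eigenvalue.
  have hμ : star (μ : ℂ) = μ := Complex.conj_ofReal μ
  rw [J_pauliVec, J_smul, J_J, ← neg_one_smul ℂ (B.ξ e.b e.a), act_smul, hμ, neg_one_smul,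
    neg_neg, smul_smul] at h4
  obtain ⟨ν, hνμ⟩ : ∃ ν : ℝ, ν = β c.X e.b e.a * -μ := ⟨_, rfl⟩
  have h5 : act (pauliVec (properVec c.X e.b e.a)) (B.ξ e.b e.a) = (ν : ℂ) • B.ξ e.b e.a := by
    have h6 : pauliVec (properVec c.X e.b e.a) =
        (β c.X e.b e.a : ℂ) • pauliVec (boostVec c.X e.b e.a) := pauliVec_smul _ _
    rw [h6, smul_act, h4, smul_smul]
    congr 1
    rw [hνμ]
    push_cast
    ring
  have h7 : ν = ∑ i, nvec (B.ξ e.b e.a) i * properVec c.X e.b e.a i := by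
    have h8 := inner_pauliVec (properVec c.X e.b e.a) (B.norm_ξ_ba e)
    rw [h5, inner_smul_right, inner_self_of_norm_one (B.norm_ξ_ba e), mul_one] at h8
    exact_mod_cast h8
  have hν : 0 < ν := by
    rw [h7, nvec_properVec]
    exact half_pos hp
  -- The Clifford relation gives `ν² = len²`, and positivity of `ν` selects the top eigenvalue.
  have h9 := pauliVec_act_act (properVec c.X e.b e.a) (B.ξ e.b e.a)
  rw [h5, act_smul, h5, smul_smul] at h9
  have h10 := smul_left_injective ℂ (ne_zero_of_norm_one (B.norm_ξ_ba e)) h9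
  have h11 : ν * ν = len (properVec c.X e.b e.a) ^ 2 := by exact_mod_cast h10
  have h12 : len (properVec c.X e.b e.a) = ν := by
    have := len_nonneg (properVec c.X e.b e.a)
    nlinarith
  refine ⟨fun h0 => ?_, by rw [h12, h5]⟩
  rw [h7, h0] at hν
  simp at hν

theorem HighestWeight.pos {B : BoundaryData} {X : Fin 5 → SL2C} {e : Triangle}
    (h : HighestWeight B X e) :
    0 < β X e.b e.a * ∑ i, nvec (B.ξ e.b e.a) i * traceVec X e.b e.a i := by
  obtain ⟨h0, h1⟩ := h
  have h2 := inner_pauliVec (properVec X e.b e.a) (B.norm_ξ_ba e)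
  rw [h1, inner_smul_right, inner_self_of_norm_one (B.norm_ξ_ba e), mul_one] at h2
  have h3 : len (properVec X e.b e.a) =
      ∑ i, nvec (B.ξ e.b e.a) i * properVec X e.b e.a i := by exact_mod_cast h2
  have h4 := len_pos h0
  rw [h3, nvec_properVec] at h4
  linarith

theorem others_comm (a b : Fin 5) : others a b = others b a := by
  funext r
  simp only [others, and_comm]

theorem β_comm (X : Fin 5 → SL2C) (a b : Fin 5) : β X a b = β X b a := by
  rw [β, β, others_comm a b, mul_comm]

/-- For unitary `X_ab` the traces `tr(σ_i X_ab X_ab†)` all vanish, contradicting the strict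
inequality. -/
theorem nonDegenerate_of_properlyOriented {B : BoundaryData} {X : Fin 5 → SL2C}
    (h : ProperlyOriented B X) : NonDegenerate X := by
  intro a b hab hU
  have h1 := (Matrix.mem_unitaryGroup_iff.1 (Matrix.mem_specialUnitaryGroup_iff.1 hU).1)
  rw [Matrix.star_eq_conjTranspose] at h1
  have h2 : ∀ i, traceVec X a b i = 0 := by
    intro i
    rw [traceVec, Matrix.mul_assoc, h1, Matrix.mul_one, Matrix.trace_fin_two]
    fin_cases i <;> simp [pauli]
  have h3 := h a b hab
  simp [h2] at h3

/-! ### Classes of spinors -/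

theorem η_eq_ξClass_iff (B : BoundaryData) (P : Point) (e : Triangle) :
    P.η e = B.ξClass e ↔ ∃ l : ℂ, hat (P.rep.η e) = l • B.ξ e.b e.a := by
  rw [← Projectivization.mk_rep (P.η e), BoundaryData.ξClass, Projectivization.mk_eq_mk_iff']
  constructor
  · rintro ⟨a, ha⟩
    obtain ⟨l, -, hl⟩ := hat_parallel (P.rep.η_ne e) ha.symm
    exact ⟨l, hl⟩
  · rintro ⟨l, hl⟩
    refine ⟨(‖P.rep.η e‖ : ℂ) * l, ?_⟩
    rw [mul_smul, ← hl]
    exact (eq_norm_smul_hat (P.rep.η_ne e)).symm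

/-- Uniqueness is automatic: `z_ab` must be proportional to `X_a ξ_ab`. -/
theorem determinedByMax_iff (B : BoundaryData) (P : Point) (e : Triangle) :
    DeterminedByMax B P e ↔ Aligned B P.rep e := by
  rw [DeterminedByMax, maxEquation_iff_aligned, and_iff_left_iff_imp]
  intro hP Q hX _ hQ
  rw [maxEquation_iff_aligned] at hQ
  obtain ⟨⟨α, h1⟩, -⟩ := hP
  obtain ⟨⟨α', h2⟩, -⟩ := hQ
  have h3 : act (P.X e.a) (B.ξ e.a e.b) = α • P.rep.z e := by
    rw [h1, act_smul]
    exact congrArg _ (act_act_inv _ _)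
  have h4 : act (P.X e.a) (B.ξ e.a e.b) = α' • Q.rep.z e := by
    rw [h2, act_smul, ← hX]
    exact congrArg _ (act_act_inv _ _)
  have hα' : α' ≠ 0 := by
    rintro rfl
    exact ne_zero_of_norm_one (B.norm_ξ_ab e) (by simpa using h2)
  rw [← Projectivization.mk_rep (P.z e), ← Projectivization.mk_rep (Q.z e),
    Projectivization.mk_eq_mk_iff']
  refine ⟨α'⁻¹ * α, ?_⟩
  rw [mul_smul]
  change α'⁻¹ • α • P.rep.z e = Q.rep.z e
  rw [← h3, h4, smul_smul, inv_mul_cancel₀ hα', one_smul]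

theorem aligned_withBoundary_iff {B : BoundaryData} {P : Point} {e : Triangle}
    (h : P.η e = B.ξClass e) : Aligned B (P.rep.withBoundary B) e ↔ Aligned B P.rep e := by
  obtain ⟨l, hl⟩ := (η_eq_ξClass_iff B P e).1 h
  have h1 : P.rep.η e = ((‖P.rep.η e‖ : ℂ) * l) • B.ξ e.b e.a := by
    rw [mul_smul, ← hl]
    exact eq_norm_smul_hat (P.rep.η_ne e)
  have h2 : (‖P.rep.η e‖ : ℂ) * l ≠ 0 := by
    intro h0
    rw [h0, zero_smul] at h1
    exact P.rep.η_ne e h1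
  constructor
  · exact fun h3 => aligned_of_smul (c := P.rep) (d := P.rep.withBoundary B) (a := 1) one_ne_zero
      rfl (one_smul ℂ _).symm h1 h3
  · refine fun h3 => aligned_of_smul (c := P.rep.withBoundary B) (d := P.rep) (a := 1)
      (b := ((‖P.rep.η e‖ : ℂ) * l)⁻¹) one_ne_zero rfl (one_smul ℂ _).symm ?_ h3
    exact (inv_smul_eq_iff₀ h2).2 h1 |>.symm

theorem aligned_withBoundary_of_toPoint {B : BoundaryData} {P : Point} {c : Configuration}
    (hc : c.toPoint = P) {e : Triangle} (h : Aligned B (P.rep.withBoundary B) e) :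
    Aligned B (c.withBoundary B) e := by
  obtain ⟨hX, hz, -⟩ := rep_of_toPoint hc
  obtain ⟨a, ha, hz⟩ := hz e
  exact aligned_of_smul (c := c.withBoundary B) (d := P.rep.withBoundary B) ha hX hz
    (one_smul ℂ _).symm h

/-! ### Critical points -/

/-- The algebraic characterization of the proper critical points. -/
structure ProperSolution (B : BoundaryData) (P : Point) : Prop where
  aligned : ∀ e, Aligned B P.rep e
  parallel : ∀ e, ∃ l : ℂ, hat (P.rep.η e) = l • B.ξ e.b e.a
  closure : Closure B
  defect_eq : ∀ e, defect P.rep e = 0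
  proper : ProperlyOriented B P.X

theorem ProperSolution.oriented {B : BoundaryData} {P : Point} (h : ProperSolution B P) :
    Oriented B P.rep :=
  (oriented_iff_defect h.aligned).2 h.defect_eq

theorem ProperSolution.highestWeight {B : BoundaryData} {P : Point} (h : ProperSolution B P)
    (e : Triangle) : HighestWeight B P.X e := by
  obtain ⟨s, E, hi⟩ := exists_intertwines h.oriented e
  obtain ⟨l, hl⟩ := h.parallel e
  have hp : ProperlyOriented B P.rep.X := h.proper
  have hw : HighestWeight B P.rep.X e :=
    Intertwines.highestWeight hi hl (hp e.b e.a (ne_of_gt e.2))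
  exact hw

/-- The projectors give the inequality only for the order `(b, a)` with `a < b`; orientation
transfers it to `(a, b)`. -/
theorem properlyOriented_of_highestWeight {B : BoundaryData} {c : Configuration}
    (ho : Oriented B c) (hl : ∀ e, ∃ l : ℂ, hat (c.η e) = l • B.ξ e.b e.a)
    (h : ∀ e, HighestWeight B c.X e) : ProperlyOriented B c.X := by
  have key : ∀ e : Triangle,
      0 < β c.X e.a e.b * ∑ i, nvec (B.ξ e.a e.b) i * traceVec c.X e.a e.b i := by
    intro e
    obtain ⟨s, E, hi⟩ := exists_intertwines ho e
    obtain ⟨l, hle⟩ := hl e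
    have h1 : ∑ i, nvec (B.ξ e.a e.b) i * traceVec c.X e.a e.b i =
        ∑ i, nvec (B.ξ e.b e.a) i * traceVec c.X e.b e.a i :=
      Intertwines.sum_nvec_eq hi hle
    rw [h1, β_comm c.X e.a e.b]
    exact (h e).pos
  intro a b hab
  rcases lt_or_gt_of_ne hab with h1 | h1
  · exact key ⟨(a, b), h1⟩
  · exact (h ⟨(b, a), h1⟩).pos

theorem phaseForm_eq_zero_of_hasDerivAt {f : ℝ → ℂ} {r : ℝ} (h : HasDerivAt f 0 0)
    (h' : HasDerivAt f (Complex.I * (r : ℂ)) 0) : r = 0 := by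
  have := (h'.unique h)
  exact_mod_cast (mul_eq_zero.1 this).resolve_left Complex.I_ne_zero

theorem ProperSolution.of_isCriticalPoint {B : BoundaryData} {γ : ℝ} {P : Point}
    (h : IsCriticalPoint B γ P) : ProperSolution B P := by
  have hre := h.re_eq_zero
  rw [properAction, Complex.add_re] at hre
  have h1 := re_eprlAction_self_le B γ P.rep
  have h2 := re_projAction_self_le B P.rep
  -- Two non-positive real parts with sum `0` both vanish.
  have hal := aligned_of_re_eprlAction B γ P.rep (fun e => (h.inDomain.2 e).1) (by linarith)
  have hpr := norm_projArg_of_re B P.rep (fun e => (h.inDomain.2 e).2) (by linarith)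
  have hpr' := fun e => (norm_projArg_eq_one_iff B P.rep e).1 (hpr e)
  have hl := fun e => (hpr' e).2
  obtain ⟨hcl, hd⟩ := (stationary_iff B γ P hal hl).1 fun c hc => by
    have hX := (rep_of_toPoint hc.start).1
    refine phaseForm_eq_zero_of_hasDerivAt (h.stationary c hc)
      (hc.hasDerivAt_properAction B γ (fun e => aligned_of_toPoint hc.start (hal e)) fun e => ?_)
    rw [norm_projArg_eq_one_iff, hX]
    exact ⟨(hpr' e).1, parallel_of_toPoint hc.start (hl e)⟩
  have hp : ProperlyOriented B P.rep.X :=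
    properlyOriented_of_highestWeight ((oriented_iff_defect hal).2 hd) hl fun e => (hpr' e).1
  exact ⟨hal, hl, hcl, hd, hp⟩

theorem ProperSolution.isCriticalPoint {B : BoundaryData} {P : Point} (h : ProperSolution B P)
    (γ : ℝ) : IsCriticalPoint B γ P := by
  have hpr : ∀ c : Configuration, c.toPoint = P → ∀ e, ‖projArg B c e‖ = 1 := by
    intro c hc e
    rw [norm_projArg_eq_one_iff, (rep_of_toPoint hc).1]
    exact ⟨h.highestWeight e, parallel_of_toPoint hc (h.parallel e)⟩
  have hprP := hpr P.rep P.rep_toPoint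
  have hre : (properAction B γ P.rep P.rep).re = 0 := by
    rw [properAction, Complex.add_re, re_eprlAction_of_aligned B γ _ h.aligned,
      re_projAction_of_norm B _ hprP, add_zero]
  refine ⟨⟨nonDegenerate_of_properlyOriented h.proper, fun e =>
    ⟨eprlArg_ne_zero_of_aligned (h.aligned e), ?_⟩⟩, hre, fun Q _ => ?_, fun c hc => ?_⟩
  · rw [← norm_ne_zero_iff, hprP e]
    exact one_ne_zero
  · rw [hre, properAction, Complex.add_re]
    exact add_nonpos (re_eprlAction_self_le B γ _) (re_projAction_self_le B _)
  · refine (hc.hasDerivAt_properAction B γ (fun e => aligned_of_toPoint hc.start (h.aligned e))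
      (hpr _ hc.start)).congr_deriv ?_
    rw [(stationary_iff B γ P h.aligned h.parallel).2 ⟨h.closure, h.defect_eq⟩ c hc]
    simp

theorem isCriticalPoint_iff (B : BoundaryData) (γ : ℝ) (P : Point) :
    (NonDegenerate P.X ∧ IsCriticalPoint B γ P) ↔ ProperSolution B P :=
  ⟨fun h => .of_isCriticalPoint h.2,
    fun h => ⟨nonDegenerate_of_properlyOriented h.proper, h.isCriticalPoint γ⟩⟩

theorem isEPRLCriticalPoint_iff {B : BoundaryData} (γ : ℝ) {P : Point}
    (hη : ∀ e, P.η e = B.ξClass e) :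
    IsEPRLCriticalPoint B γ P ↔
      (∀ e, Aligned B P.rep e) ∧ Closure B ∧ ∀ e, defect P.rep e = 0 := by
  have hl := fun e => (η_eq_ξClass_iff B P e).1 (hη e)
  constructor
  · intro h
    have hal := aligned_of_re_eprlAction B γ _ h.inDomain h.re_eq_zero
    have hal' := fun e => (aligned_withBoundary_iff (hη e)).1 (hal e)
    exact ⟨hal', (stationary_iff B γ P hal' hl).1 fun c hc =>
      phaseForm_eq_zero_of_hasDerivAt (h.stationary c hc)
        (hc.hasDerivAt_eprlAction_withBoundary B γ
          fun e => aligned_withBoundary_of_toPoint hc.start (hal e))⟩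
  · rintro ⟨hal', hst⟩
    have hal := fun e => (aligned_withBoundary_iff (hη e)).2 (hal' e)
    have hre := re_eprlAction_of_aligned B γ _ hal
    refine ⟨fun e => eprlArg_ne_zero_of_aligned (hal e), hre, fun Q _ => ?_, fun c hc => ?_⟩
    · rw [hre]
      exact re_eprlAction_self_le B γ _
    · refine (hc.hasDerivAt_eprlAction_withBoundary B γ
        fun e => aligned_withBoundary_of_toPoint hc.start (hal e)).congr_deriv ?_
      rw [(stationary_iff B γ P hal' hl).2 hst c hc]
      simp

end SpinFoam

end

theorem theorem2 (B : SpinFoam.BoundaryData) (γ : ℝ) (P : SpinFoam.Point) :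
    ((SpinFoam.NonDegenerate P.X ∧ SpinFoam.IsCriticalPoint B γ P) ↔
      (SpinFoam.Closure B ∧ SpinFoam.Oriented B P.rep ∧ SpinFoam.ProperlyOriented B P.X ∧
        ∀ e : SpinFoam.Triangle, P.η e = B.ξClass e ∧ SpinFoam.DeterminedByMax B P e)) ∧
    ((SpinFoam.NonDegenerate P.X ∧ SpinFoam.IsCriticalPoint B γ P) ↔
      (SpinFoam.IsEPRLCriticalPoint B γ P ∧ SpinFoam.ProperlyOriented B P.X ∧
        ∀ e : SpinFoam.Triangle, P.η e = B.ξClass e)) := by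
  rw [SpinFoam.isCriticalPoint_iff]
  constructor
  · simp only [SpinFoam.determinedByMax_iff, SpinFoam.η_eq_ξClass_iff]
    constructor
    · exact fun h => ⟨h.closure, h.oriented, h.proper, fun e => ⟨h.parallel e, h.aligned e⟩⟩
    · rintro ⟨hcl, ho, hp, h⟩
      exact ⟨fun e => (h e).2, fun e => (h e).1, hcl,
        (SpinFoam.oriented_iff_defect fun e => (h e).2).1 ho, hp⟩
  · constructor
    · intro h
      have hη := fun e => (SpinFoam.η_eq_ξClass_iff B P e).2 (h.parallel e)
      exact ⟨(SpinFoam.isEPRLCriticalPoint_iff γ hη).2 ⟨h.aligned, h.closure, h.defect_eq⟩,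
        h.proper, hη⟩
    · rintro ⟨hE, hp, hη⟩
      obtain ⟨hal, hcl, hd⟩ := (SpinFoam.isEPRLCriticalPoint_iff γ hη).1 hE
      exact ⟨hal, fun e => (SpinFoam.η_eq_ξClass_iff B P e).1 (hη e), hcl, hd, hp⟩
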